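/- **Setting.** For real random variables $U_1,\dots,U_m$ on a common probability space with moments of all orders, the joint cumulant is $$\mathbf C(U_1,\dots,U_m)=i^{-m}\,\frac{\partial^m}{\partial t_1\cdots\partial t_m}\log \mathbf E\exp\Big(\sum_{j=1}^m i\,t_jU_j\Big)\Big|_{t_1=\dots=t_m=0}.$$ $\mathrm{Part}(m)$ is the set of all set partitions of $\{1,\dots,m\}$, $\mathrm{Part}_2(m)$ the set of those all of whose parts have at least two elements, $\#\Pi$ the number of parts of $\Pi$, and $\Pi\vee\Sigma$ the join (the finest partition refined by both $\Pi$ and $\Sigma$). For $\Pi\in\mathrm{Part}(m)$ put $\mathbf C_\Pi(U_1,\dots,U_m)=\prod_{A\in\Pi}\mathbf C\{U_i\}_{i\in A}$. A $(p,m)$-word is a function $\mathbf j:\{1,\dots,m\}\to\{1,\dots,p\}$; it is $\Pi$-measurable if it is constant on each part of $\Pi$. Let $\{Z_j\}_{j\in\mathbb Z}$ be a (strictly) stationary sequence of real random variables with $\mathbf E|Z_0|^q<\infty$ for all integers $q\ge1$ and $\mathbf EZ_0=0$, and let $\{Z^{(i)}_j\}_{j\in\mathbb Z}$, $i=1,2,\dots$,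 be i.i.d. copies of this sequence. Let $p,n\ge1$ be integers and $b>0$ a real number. Let $X$ be the $n\times p$ matrix with $X(i,j)=Z^{(i)}_j/\sqrt n$, let $B$ be the $p\times p$ matrix with $B(i,j)=1$ if $|i-j|\le b$ and $B(i,j)=0$ otherwise, and let $Y$ be the $p\times p$ matrix with $Y(i,j)=B(i,j)\,(X^TX)(i,j)$. Let $r\ge1$ and $k_1,\dots,k_r\ge1$ be integers, $k=k_1+\dots+k_r$, and $K_i=2\sum_{j\le i}k_j$ for $0\le i\le r$. Let $\Pi_0,\Pi_1\in\mathrm{Part}(2k)$ be the perfect matchings $$\Pi_0=\big\{\{2\alpha-1,2\alpha\}:1\le\alpha\le k\big\},\qquad \Pi_1=\bigcup_{i=1}^r\Big(\big\{\{K_{i-1}+2t,\,K_{i-1}+2t+1\}:1\le t\le k_i-1\big\}\cup\big\{\{K_i,\,K_{i-1}+1\}\big\}\Big).$$ For a $(p,2k)$-word $\mathbf j$ and $\Pi\in\mathrm{Part}(2k)$ put $$B(\mathbf j)=\prod_{\alpha=1}^{k}B(\mathbf j(2\alpha-1),\mathbf j(2\alpha)),\qquad C_\Pi(\mathbf j)=\mathbf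 C_\Pi(Z_{\mathbf j(1)},\dots,Z_{\mathbf j(2k)}).$$ **Proposition 5.2.** With this notation, $$\mathbf C(\operatorname{trace}Y^{k_1},\dots,\operatorname{trace}Y^{k_r})=\sum_{\substack{\Pi\in\mathrm{Part}_2(2k)\\ \#(\Pi_0\vee\Pi_1\vee\Pi)=1}} n^{-k+\#(\Pi_0\vee\Pi)}\sum_{\substack{\mathbf j\ \text{a }(p,2k)\text{-word},\\ \mathbf j\ \Pi_1\text{-measurable}}}B(\mathbf j)\,C_\Pi(\mathbf j).$$ -/

import Mathlib

open MeasureTheory ProbabilityTheory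

noncomputable section

/-! ### Set partitions -/

/-- `SetPart m` is the set of all set partitions of an `m`-element index set `Fin m`
(families of nonempty, pairwise disjoint sets with union everything).
Mathlib's order on it is refinement: `P ≤ Q` iff every part of `P` is contained in a part of `Q`. -/
abbrev SetPart (m : ℕ) : Type := Finpartition (Finset.univ : Finset (Fin m))

namespace SetPart

variable {m : ℕ}

/-- The partition of `Fin m` into the nonempty level sets of `f`. -/
def levelSets {β : Type*} (f : Fin m → β) : SetPart m :=
  @Finpartition.ofSetoid (Fin m) _ _ (Setoid.ker f) (Classical.decRel _)

/-- The equivalence relation generated by "lying in a common part of `P` or of `Q`". -/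
def joinSetoid (P Q : SetPart m) : Setoid (Fin m) :=
  Relation.EqvGen.setoid fun a b => b ∈ P.part a ∨ b ∈ Q.part a

/-- The join `P ∨ Q`, as the family of classes of the equivalence relation generated by the two
partitions; it is shown below to be the least upper bound for the refinement order. -/
def join (P Q : SetPart m) : SetPart m :=
  @Finpartition.ofSetoid (Fin m) _ _ (joinSetoid P Q) (Classical.decRel _)

theorem mem_part_join {P Q : SetPart m} {a b : Fin m} :
    b ∈ (join P Q).part a ↔ joinSetoid P Q a b :=
  @Finpartition.mem_part_ofSetoid_iff_rel (Fin m) _ _ _ (joinSetoid P Q) (Classical.decRel _) b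

theorem mem_part_levelSets {β : Type*} {f : Fin m → β} {a b : Fin m} :
    b ∈ (levelSets f).part a ↔ f a = f b :=
  @Finpartition.mem_part_ofSetoid_iff_rel (Fin m) _ _ _ (Setoid.ker f) (Classical.decRel _) b

theorem le_iff_part {P Q : SetPart m} : P ≤ Q ↔ ∀ a b, b ∈ P.part a → b ∈ Q.part a := by
  constructor
  · intro h a b hb
    obtain ⟨B, hB, hAB⟩ := h (P.part_mem.2 (Finset.mem_univ a))
    have ha : a ∈ B := hAB (P.mem_part_self.2 (Finset.mem_univ a))
    rw [Q.part_eq_of_mem hB ha]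
    exact hAB hb
  · intro h A hA
    obtain ⟨a, ha⟩ := P.nonempty_of_mem_parts hA
    refine ⟨Q.part a, Q.part_mem.2 (Finset.mem_univ a), fun b hb => h a b ?_⟩
    rwa [P.part_eq_of_mem hA ha]

instance : SemilatticeSup (SetPart m) :=
  { (inferInstance : PartialOrder (SetPart m)) with
    sup := join
    le_sup_left := fun P Q => le_iff_part.2 fun a b h =>
      mem_part_join.2 (Relation.EqvGen.rel _ _ (Or.inl h))
    le_sup_right := fun P Q => le_iff_part.2 fun a b h =>
      mem_part_join.2 (Relation.EqvGen.rel _ _ (Or.inr h))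
    sup_le := fun P Q R hP hQ => le_iff_part.2 fun a b h => by
      have h' := mem_part_join.1 h
      clear h
      induction h' with
      | rel x y hxy =>
        rcases hxy with hxy | hxy
        · exact le_iff_part.1 hP x y hxy
        · exact le_iff_part.1 hQ x y hxy
      | refl x => exact R.mem_part_self.2 (Finset.mem_univ x)
      | symm x y _ ih =>
        rw [R.mem_part_iff_part_eq_part (Finset.mem_univ _) (Finset.mem_univ _)] at ih ⊢
        exact ih.symm
      | trans x y z _ _ ih1 ih2 =>
        rw [R.mem_part_iff_part_eq_part (Finset.mem_univ _) (Finset.mem_univ _)] at ih1 ih2 ⊢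
        exact ih2.trans ih1 }

/-- `Π`-measurability: the function `f` is constant on each part of `P`. -/
abbrev IsMeasurable {β : Type*} (P : SetPart m) (f : Fin m → β) : Prop :=
  ∀ A ∈ P.parts, ∀ a ∈ A, ∀ b ∈ A, f a = f b

/-- The partitions in which every part has at least two elements. -/
abbrev IsPart₂ (P : SetPart m) : Prop := ∀ A ∈ P.parts, 2 ≤ A.card

/-- The perfect matching `{{1,2},{3,4},…,{2k-1,2k}}`; here the position `a ∈ {1,…,2k}` is the
element `a - 1` of `Fin (2 * k)`. -/
def matching₀ (k : ℕ) : SetPart (2 * k) := levelSets fun a => (a : ℕ) / 2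

/-- The position in the concatenation of `r` consecutive blocks of lengths `2 k_1, …, 2 k_r`, given
as a pair (block, position within the block, counted from `0`). -/
def blockPos {r : ℕ} (k : Fin r → ℕ) (a : Fin (2 * ∑ i, k i)) : (i : Fin r) × Fin (2 * k i) :=
  finSigmaFinEquiv.symm (Fin.cast (Finset.mul_sum Finset.univ k 2) a)

/-- The perfect matching
`{{2,3},…,{K_1,1}, {K_1+2,K_1+3},…,{K_2,K_1+1}, …}`, `K_i = 2 (k_1 + ⋯ + k_i)`: in each block the
pairs are `{2,3},{4,5},…` and the last position is matched with the first one. Counting from `0`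
within a block of length `2 k_i`, positions `s` are paired by the value of
`⌊((s + 1) mod 2 k_i) / 2⌋`. -/
def matching₁ {r : ℕ} (k : Fin r → ℕ) : SetPart (2 * ∑ i, k i) :=
  levelSets fun a =>
    ((blockPos k a).1, (((blockPos k a).2 : ℕ) + 1) % (2 * k (blockPos k a).1) / 2)

end SetPart

/-! ### Joint cumulants -/

/-- The joint characteristic function `t ↦ E exp (∑ⱼ i tⱼ Xⱼ)`. -/
def jointCharFun {Ω : Type*} [MeasurableSpace Ω] (μ : Measure Ω) {r : ℕ}
    (X : Fin r → Ω → ℝ) (t : Fin r → ℝ) : ℂ :=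
  ∫ ω, Complex.exp (∑ j, Complex.I * (t j : ℂ) * (X j ω : ℂ)) ∂μ

/-- The joint cumulant
`C(X_1,…,X_r) = i^{-r} ∂^r/∂t_1⋯∂t_r log E exp (∑ⱼ i tⱼ Xⱼ)` at `t = 0`.
The mixed partial derivative is the `r`-th Fréchet derivative at `0` evaluated at the standard
basis vectors. -/
def jointCumulant {Ω : Type*} [MeasurableSpace Ω] (μ : Measure Ω) {r : ℕ}
    (X : Fin r → Ω → ℝ) : ℂ :=
  (Complex.I ^ r)⁻¹ *
    iteratedFDeriv ℝ r (fun t : Fin r → ℝ => Complex.log (jointCharFun μ X t)) 0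
      (fun j => Pi.single j 1)

/-- `C_Π(X_1,…,X_m) = ∏_{A ∈ Π} C{X_i}_{i ∈ A}`, the elements of `A` being listed increasingly. -/
def partCumulant {Ω : Type*} [MeasurableSpace Ω] (μ : Measure Ω) {m : ℕ}
    (P : SetPart m) (X : Fin m → Ω → ℝ) : ℂ :=
  ∏ A ∈ P.parts, jointCumulant μ fun i : Fin A.card => X (A.orderEmbOfFin rfl i)

/-! ### The matrix model

The index `j ∈ {1,…,p}` of the text is the element `j - 1` of `Fin p`. -/

/-- The `p × p` band matrix `B`. -/
def bandMatrix (b : ℝ) (p : ℕ) : Matrix (Fin p) (Fin p) ℝ :=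
  Matrix.of fun i j => if |((i : ℕ) : ℝ) - ((j : ℕ) : ℝ)| ≤ b then 1 else 0

/-- The `n × p` data matrix `X(i,j) = Z_j^{(i)} / √n`, for a realization `z i j = Z_j^{(i)}`;
the rows `i = 1,…,n` use the copies number `0,…,n-1`. -/
def dataMatrix (n p : ℕ) (z : ℕ → ℤ → ℝ) : Matrix (Fin n) (Fin p) ℝ :=
  Matrix.of fun i j => z i (((j : ℕ) : ℤ) + 1) / √(n : ℝ)

/-- The banded sample covariance matrix `Y(i,j) = B(i,j) (Xᵀ X)(i,j)`. -/
def bandedCov (b : ℝ) (n p : ℕ) (z : ℕ → ℤ → ℝ) : Matrix (Fin p) (Fin p) ℝ :=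
  Matrix.of fun i j =>
    bandMatrix b p i j * ((dataMatrix n p z).transpose * dataMatrix n p z) i j

/-- `B(𝐣) = ∏_{α = 1}^{k} B(𝐣(2α-1), 𝐣(2α))` for a `(p,2k)`-word `𝐣`. -/
def bandWord (b : ℝ) {p k : ℕ} (w : Fin (2 * k) → Fin p) : ℝ :=
  ∏ α : Fin k, bandMatrix b p (w ⟨2 * (α : ℕ), by omega⟩) (w ⟨2 * (α : ℕ) + 1, by omega⟩)

/-- `C_Π(𝐣) = C_Π(Z_{𝐣(1)},…,Z_{𝐣(2k)})` for a `(p,2k)`-word `𝐣`. -/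
def wordCumulant {Ω : Type*} [MeasurableSpace Ω] (μ : Measure Ω) (Z : ℤ → Ω → ℝ) {p m : ℕ}
    (P : SetPart m) (w : Fin m → Fin p) : ℂ :=
  partCumulant μ P fun a => Z (((w a : ℕ) : ℤ) + 1)

end

/-!
The cumulants `K T` of a family of random variables are determined by the moments
`M S = E ∏_{i ∈ S} X i` through the recursion `M S = ∑_{a ∈ T ⊆ S} K T * M (S \ T)`, which needs to
be known only for one element `a` of each nonempty set `S` (`eq_combCumulant_of_subset`). Every fact
about cumulants used here is proved by exhibiting a solution of this recursion.

* The mixed derivatives of `log φ`, for the characteristic function `φ`, solve it by the Leibniz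
  rule applied to `φ' = (log φ)' φ`; so the joint cumulant defined by derivatives is the
  combinatorial one (`jointCumulant_eq_combCumulant`).
* Sums over set partitions solve it when the partitions are sorted by the component of `a`. With
  blocks of variables, the component being taken in the graph of blocks, this is the formula of
  Leonov and Shiryaev for cumulants of products (`combCumulant_blockUnion`).
* Cumulants are multilinear (`cumulantMap`), and they vanish when the variables split into two
  independent groups (`combCumulant_eq_zero`).

The trace of a power of the banded matrix is a sum over cyclic words of column indices and words of
row indices (`trace_bandedCov_pow`). By multilinearity and the formula of Leonov and Shiryaev the
joint cumulant of the traces becomes a sum over these words and over the partitions `Q` that connect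
the blocks, and connecting the blocks means that the join of `Q` with the two matchings is trivial,
because the matchings together have the blocks as classes (`connectsBlocks_iff`). For fixed `Q` the
independence of the rows kills all row words that are not constant on the parts of the join of `Q`
with the first matching (`sum_rows_prod_combCumulant`), and there are `n` to the number of these
parts many remaining ones (`card_rows_isMeasurable`). Partitions with singletons contribute nothing
since the variables are centred.
-/

/-! ### Partitions of finite sets and connectedness relative to blocks -/

section Partitions

open Finset

variable {ι κ : Type*}

/-- The family `P` of finite sets is a set partition of `V`. Families of finite sets are used in
place of `Finpartition V`, so that partitions of different sets live in the same type. -/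
structure IsPartitionOf (P : Finset (Finset ι)) (V : Finset ι) : Prop where
  nonempty : ∀ A ∈ P, A.Nonempty
  mem_iff : ∀ x, (∃ A ∈ P, x ∈ A) ↔ x ∈ V
  eq_of_mem : ∀ A ∈ P, ∀ B ∈ P, ∀ x, x ∈ A → x ∈ B → A = B

theorem IsPartitionOf.subset {P : Finset (Finset ι)} {V : Finset ι} (h : IsPartitionOf P V)
    {A : Finset ι} (hA : A ∈ P) : A ⊆ V := fun x hx => (h.mem_iff x).1 ⟨A, hA, hx⟩

open Classical in
/-- The finite set of all set partitions of `V`. -/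
noncomputable def partitionsOf (V : Finset ι) : Finset (Finset (Finset ι)) :=
  V.powerset.powerset.filter fun P => IsPartitionOf P V

theorem mem_partitionsOf {P : Finset (Finset ι)} {V : Finset ι} :
    P ∈ partitionsOf V ↔ IsPartitionOf P V := by
  classical
  simp only [partitionsOf, mem_filter, mem_powerset, and_iff_right_iff_imp]
  exact fun h A hA => mem_powerset.2 (h.subset hA)

variable {R : Type*} [CommRing R]

/-- The sum over all set partitions of `V` of the product of the weights of the parts. -/
noncomputable def partitionSum (f : Finset ι → R) (V : Finset ι) : R :=
  ∑ P ∈ partitionsOf V, ∏ A ∈ P, f A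

theorem partitionSum_empty (f : Finset ι → R) : partitionSum f ∅ = 1 := by
  have : partitionsOf (∅ : Finset ι) = {∅} := by
    ext P
    rw [mem_partitionsOf, mem_singleton]
    constructor
    · intro h
      refine eq_empty_of_forall_notMem fun A hA => ?_
      obtain ⟨x, hx⟩ := h.nonempty A hA
      exact notMem_empty x (h.subset hA hx)
    · rintro rfl
      exact ⟨by simp, by simp, by simp⟩
  rw [partitionSum, this]
  simp

/-- For a block map `β`, the set of blocks `T` is closed under the relation "some part of `P` meets
both blocks". -/
def IsSaturated (β : ι → κ) (P : Finset (Finset ι)) (T : Finset κ) : Prop :=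
  ∀ A ∈ P, ∀ x ∈ A, ∀ y ∈ A, β x ∈ T → β y ∈ T

/-- The parts of `P` connect the blocks in `S`: no nonempty proper subset of `S` is saturated. -/
def ConnectsBlocks (β : ι → κ) (P : Finset (Finset ι)) (S : Finset κ) : Prop :=
  ∀ T ⊆ S, T.Nonempty → IsSaturated β P T → T = S

variable [Fintype ι] [DecidableEq κ]

/-- The union of the blocks with index in `S`. -/
def blockUnion (β : ι → κ) (S : Finset κ) : Finset ι := univ.filter fun x => β x ∈ S

@[simp] theorem mem_blockUnion {β : ι → κ} {S : Finset κ} {x : ι} :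
    x ∈ blockUnion β S ↔ β x ∈ S := by simp [blockUnion]

theorem IsSaturated.subset_blockUnion {β : ι → κ} {P : Finset (Finset ι)} {T : Finset κ}
    (h : IsSaturated β P T) {A : Finset ι} (hA : A ∈ P) {x : ι} (hx : x ∈ A) (hT : β x ∈ T) :
    A ⊆ blockUnion β T := fun y hy => mem_blockUnion.2 (h A hA x hx y hy hT)

theorem IsSaturated.sdiff {β : ι → κ} {P : Finset (Finset ι)} {S T : Finset κ}
    (hP : IsPartitionOf P (blockUnion β S)) (hT : IsSaturated β P T) :
    IsSaturated β P (S \ T) := by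
  intro A hA x hx y hy hxm
  rw [mem_sdiff] at hxm ⊢
  exact ⟨mem_blockUnion.1 (hP.subset hA hy), fun h => hxm.2 (hT A hA y hy x hx h)⟩

variable [DecidableEq ι]

@[simp] theorem blockUnion_id (S : Finset ι) : blockUnion id S = S := by ext; simp

/-- Each block lies in exactly one connected component. -/
theorem existsUnique_component (β : ι → κ) {P : Finset (Finset ι)} {S : Finset κ}
    (hP : IsPartitionOf P (blockUnion β S)) {a : κ} (ha : a ∈ S) :
    ∃! T, T ∈ S.powerset ∧ a ∈ T ∧ IsSaturated β P T ∧
      ConnectsBlocks β (P.filter (· ⊆ blockUnion β T)) T := by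
  classical
  -- the component is the intersection of all saturated sets containing `a`
  let C := S.filter fun b => ∀ T, IsSaturated β P T → a ∈ T → b ∈ T
  have hCle : ∀ T, IsSaturated β P T → a ∈ T → C ⊆ T := fun T hT haT b hb =>
    (mem_filter.1 hb).2 T hT haT
  have hCsat : IsSaturated β P C := by
    intro A hA x hx y hy hxC
    refine mem_filter.2 ⟨mem_blockUnion.1 (hP.subset hA hy), fun T hT haT => ?_⟩
    exact hT A hA x hx y hy ((mem_filter.1 hxC).2 T hT haT)
  have haC : a ∈ C := mem_filter.2 ⟨ha, fun _ _ h => h⟩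
  have hext : ∀ U, IsSaturated β P U → ∀ T ⊆ U,
      IsSaturated β (P.filter (· ⊆ blockUnion β U)) T → IsSaturated β P T := by
    intro U hU T hTU hT A hA x hx y hy hxT
    exact hT A (mem_filter.2 ⟨hA, hU.subset_blockUnion hA hx (hTU hxT)⟩) x hx y hy hxT
  refine ⟨C, ⟨mem_powerset.2 (filter_subset _ _), haC, hCsat, ?_⟩, ?_⟩
  · intro T hTC hTne hT
    have hT' := hext C hCsat T hTC hT
    by_cases haT : a ∈ T
    · exact hTC.antisymm (hCle T hT' haT)
    · have hsd : IsSaturated β P (C \ T) := by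
        intro A hA x hx y hy hxm
        rw [mem_sdiff] at hxm ⊢
        exact ⟨hCsat A hA x hx y hy hxm.1, fun h => hxm.2 (hT' A hA y hy x hx h)⟩
      obtain ⟨t, ht⟩ := hTne
      exact absurd ht (mem_sdiff.1 (hCle _ hsd (mem_sdiff.2 ⟨haC, haT⟩) (hTC ht))).2
  · rintro T ⟨-, haT, hT, hconn⟩
    refine (hconn C (hCle T hT haT) ⟨a, haC⟩ ?_).symm
    intro A hA
    exact hCsat A (mem_filter.1 hA).1

/-- The parts inside a saturated set of blocks form a partition of their union. -/
theorem IsPartitionOf.filter_subset {β : ι → κ} {P : Finset (Finset ι)} {S T : Finset κ}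
    (hP : IsPartitionOf P (blockUnion β S)) (hTS : T ⊆ S) (hT : IsSaturated β P T) :
    IsPartitionOf (P.filter (· ⊆ blockUnion β T)) (blockUnion β T) where
  nonempty A hA := hP.nonempty A (mem_filter.1 hA).1
  mem_iff x := by
    constructor
    · rintro ⟨A, hA, hx⟩
      exact (mem_filter.1 hA).2 hx
    · intro hx
      rw [mem_blockUnion] at hx
      obtain ⟨A, hA, hxA⟩ := (hP.mem_iff x).2 (mem_blockUnion.2 (hTS hx))
      exact ⟨A, mem_filter.2 ⟨hA, hT.subset_blockUnion hA hxA hx⟩, hxA⟩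
  eq_of_mem A hA B hB := hP.eq_of_mem A (mem_filter.1 hA).1 B (mem_filter.1 hB).1

theorem IsPartitionOf.filter_union {β : ι → κ} {P : Finset (Finset ι)} {S T : Finset κ}
    (hP : IsPartitionOf P (blockUnion β S)) (hT : IsSaturated β P T) :
    P.filter (· ⊆ blockUnion β T) ∪ P.filter (· ⊆ blockUnion β (S \ T)) = P := by
  ext A
  simp only [mem_union, mem_filter]
  constructor
  · rintro (h | h) <;> exact h.1
  · intro hA
    obtain ⟨x, hx⟩ := hP.nonempty A hA
    by_cases hxT : β x ∈ T
    · exact Or.inl ⟨hA, hT.subset_blockUnion hA hx hxT⟩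
    · exact Or.inr ⟨hA, (hT.sdiff hP).subset_blockUnion hA hx
        (mem_sdiff.2 ⟨mem_blockUnion.1 (hP.subset hA hx), hxT⟩)⟩

/-- Partitions of two disjoint unions of blocks are glued to one partition, from which they are
recovered. -/
theorem IsPartitionOf.union {β : ι → κ} {P₁ P₂ : Finset (Finset ι)} {S T : Finset κ}
    (hTS : T ⊆ S) (h₁ : IsPartitionOf P₁ (blockUnion β T))
    (h₂ : IsPartitionOf P₂ (blockUnion β (S \ T))) :
    IsPartitionOf (P₁ ∪ P₂) (blockUnion β S) ∧ IsSaturated β (P₁ ∪ P₂) T ∧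
      (P₁ ∪ P₂).filter (· ⊆ blockUnion β T) = P₁ ∧
      (P₁ ∪ P₂).filter (· ⊆ blockUnion β (S \ T)) = P₂ ∧ Disjoint P₁ P₂ := by
  have m₁ : ∀ A ∈ P₁, ∀ x ∈ A, β x ∈ T := fun A hA x hx => mem_blockUnion.1 (h₁.subset hA hx)
  have m₂ : ∀ A ∈ P₂, ∀ x ∈ A, β x ∈ S ∧ β x ∉ T := fun A hA x hx =>
    mem_sdiff.1 (mem_blockUnion.1 (h₂.subset hA hx))
  refine ⟨⟨?_, ?_, ?_⟩, ?_, ?_, ?_, ?_⟩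
  · intro A hA
    rcases mem_union.1 hA with h | h
    exacts [h₁.nonempty A h, h₂.nonempty A h]
  · intro x
    rw [mem_blockUnion]
    constructor
    · rintro ⟨A, hA, hx⟩
      rcases mem_union.1 hA with h | h
      exacts [hTS (m₁ A h x hx), (m₂ A h x hx).1]
    · intro hx
      by_cases hxT : β x ∈ T
      · obtain ⟨A, hA, hxA⟩ := (h₁.mem_iff x).2 (mem_blockUnion.2 hxT)
        exact ⟨A, mem_union_left _ hA, hxA⟩
      · obtain ⟨A, hA, hxA⟩ := (h₂.mem_iff x).2 (mem_blockUnion.2 (mem_sdiff.2 ⟨hx, hxT⟩))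
        exact ⟨A, mem_union_right _ hA, hxA⟩
  · intro A hA B hB x hxA hxB
    rcases mem_union.1 hA with h | h <;> rcases mem_union.1 hB with h' | h'
    · exact h₁.eq_of_mem A h B h' x hxA hxB
    · exact absurd (m₁ A h x hxA) (m₂ B h' x hxB).2
    · exact absurd (m₁ B h' x hxB) (m₂ A h x hxA).2
    · exact h₂.eq_of_mem A h B h' x hxA hxB
  · intro A hA x hx y hy hxT
    rcases mem_union.1 hA with h | h
    · exact m₁ A h y hy
    · exact absurd hxT (m₂ A h x hx).2
  · ext A
    simp only [mem_filter, mem_union]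
    constructor
    · rintro ⟨h | h, hA⟩
      · exact h
      · obtain ⟨x, hx⟩ := h₂.nonempty A h
        exact absurd (mem_blockUnion.1 (hA hx)) (m₂ A h x hx).2
    · exact fun h => ⟨Or.inl h, h₁.subset h⟩
  · ext A
    simp only [mem_filter, mem_union]
    constructor
    · rintro ⟨h | h, hA⟩
      · obtain ⟨x, hx⟩ := h₁.nonempty A h
        exact absurd (m₁ A h x hx) (mem_sdiff.1 (mem_blockUnion.1 (hA hx))).2
      · exact h
    · exact fun h => ⟨Or.inr h, h₂.subset h⟩
  · rw [disjoint_left]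
    intro A h h'
    obtain ⟨x, hx⟩ := h₁.nonempty A h
    exact (m₂ A h' x hx).2 (m₁ A h x hx)

open Classical in
/-- The sum over those set partitions of the blocks in `S` that connect them of the product of the
weights of the parts. -/
noncomputable def connectedSum (β : ι → κ) (f : Finset ι → R) (S : Finset κ) : R :=
  ∑ P ∈ partitionsOf (blockUnion β S) with ConnectsBlocks β P S, ∏ A ∈ P, f A

/-- Sorting the partitions by the connected component of the block `a`. -/
theorem partitionSum_blockUnion (β : ι → κ) (f : Finset ι → R) {S : Finset κ} {a : κ}
    (ha : a ∈ S) :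
    partitionSum f (blockUnion β S) = ∑ T ∈ S.powerset with a ∈ T,
      connectedSum β f T * partitionSum f (blockUnion β (S \ T)) := by
  classical
  have h1 : partitionSum f (blockUnion β S) =
      ∑ P ∈ partitionsOf (blockUnion β S), ∑ T ∈ S.powerset with a ∈ T,
        if IsSaturated β P T ∧ ConnectsBlocks β (P.filter (· ⊆ blockUnion β T)) T then
          ∏ A ∈ P, f A else 0 := by
    refine sum_congr rfl fun P hP => ?_
    obtain ⟨T, ⟨hT1, hT2, hT3⟩, huniq⟩ :=
      existsUnique_component β (mem_partitionsOf.1 hP) ha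
    rw [sum_eq_single_of_mem T (mem_filter.2 ⟨hT1, hT2⟩), if_pos hT3]
    intro T' hT' hne
    rw [mem_filter] at hT'
    exact if_neg fun h => hne (huniq T' ⟨hT'.1, hT'.2, h⟩)
  rw [h1, sum_comm]
  refine sum_congr rfl fun T hT => ?_
  have hTS : T ⊆ S := mem_powerset.1 (mem_filter.1 hT).1
  rw [← sum_filter, connectedSum, partitionSum, sum_mul_sum, ← sum_product']
  refine sum_nbij' (fun P => (P.filter (· ⊆ blockUnion β T), P.filter (· ⊆ blockUnion β (S \ T))))
    (fun Q => Q.1 ∪ Q.2) ?_ ?_ ?_ ?_ ?_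
  · intro P hP
    simp only [mem_filter, mem_partitionsOf] at hP
    simp only [mem_product, mem_filter, mem_partitionsOf]
    exact ⟨⟨hP.1.filter_subset hTS hP.2.1, hP.2.2⟩,
      hP.1.filter_subset sdiff_subset (hP.2.1.sdiff hP.1)⟩
  · rintro ⟨P₁, P₂⟩ hP
    simp only [mem_product, mem_filter, mem_partitionsOf] at hP
    obtain ⟨hu, hs, hf, -, -⟩ := IsPartitionOf.union hTS hP.1.1 hP.2
    simp only [mem_filter, mem_partitionsOf]
    exact ⟨hu, hs, hf.symm ▸ hP.1.2⟩
  · intro P hP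
    simp only [mem_filter, mem_partitionsOf] at hP
    exact hP.1.filter_union hP.2.1
  · rintro ⟨P₁, P₂⟩ hP
    simp only [mem_product, mem_filter, mem_partitionsOf] at hP
    obtain ⟨-, -, hf, hf', -⟩ := IsPartitionOf.union hTS hP.1.1 hP.2
    exact Prod.ext hf hf'
  · intro P hP
    simp only [mem_filter, mem_partitionsOf] at hP
    obtain ⟨-, -, -, -, hd⟩ := IsPartitionOf.union hTS (hP.1.filter_subset hTS hP.2.1)
      (hP.1.filter_subset sdiff_subset (hP.2.1.sdiff hP.1))
    rw [← prod_union hd, hP.1.filter_union hP.2.1]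

/-- Only the one-part partition connects blocks that are singletons. -/
theorem connectedSum_id (f : Finset ι → R) {S : Finset ι} (hS : S.Nonempty) :
    connectedSum id f S = f S := by
  classical
  have : (partitionsOf (blockUnion id S)).filter (fun P => ConnectsBlocks id P S) = {{S}} := by
    ext P
    simp only [mem_filter, mem_partitionsOf, mem_singleton, blockUnion_id]
    constructor
    · rintro ⟨hP, hc⟩
      have hall : ∀ A ∈ P, A = S := fun A hA =>
        hc A (hP.subset hA) (hP.nonempty A hA) fun B hB x hx y hy hxA => by
          rwa [hP.eq_of_mem A hA B hB x hxA hx]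
      obtain ⟨x, hx⟩ := hS
      obtain ⟨A, hA, -⟩ := (hP.mem_iff x).2 hx
      exact eq_singleton_iff_unique_mem.2 ⟨hall A hA ▸ hA, hall⟩
    · rintro rfl
      refine ⟨⟨by simpa using hS, by simp, by simp⟩, ?_⟩
      rintro T hTS ⟨t, ht⟩ hT
      exact hTS.antisymm fun y hy => hT S (mem_singleton_self S) t (hTS ht) y hy ht
  rw [connectedSum, this]
  simp

/-- Sorting the partitions by the part containing `a`. -/
theorem partitionSum_eq_sum (f : Finset ι → R) {S : Finset ι} {a : ι} (ha : a ∈ S) :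
    partitionSum f S = ∑ T ∈ S.powerset with a ∈ T, f T * partitionSum f (S \ T) := by
  have h := partitionSum_blockUnion id f ha
  simp only [blockUnion_id] at h
  rw [h]
  refine sum_congr rfl fun T hT => ?_
  rw [connectedSum_id f ⟨a, (mem_filter.1 hT).2⟩]

end Partitions

/-! ### Combinatorial cumulants -/

section Cumulants

open Finset

variable {ι κ : Type*} [DecidableEq ι] [DecidableEq κ] {R : Type*} [CommRing R]

/-- The cumulants `K` belonging to moments `M` (`M S` is the mean of the product of the variables
with index in `S`), solved recursively from `M S = ∑_{a ∈ T ⊆ S} K T * M (S \ T)` with an arbitrary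
choice of `a ∈ S`; by `moment_eq_sum` the identity then holds for every `a ∈ S`. The value at `∅` is
irrelevant. -/
noncomputable def combCumulant (M : Finset ι → R) (S : Finset ι) : R :=
  if h : S.Nonempty then
    M S - ∑ T ∈ (S.powerset.filter fun T => h.choose ∈ T ∧ T ≠ S).attach,
      combCumulant M T.1 * M (S \ T.1)
  else 0
termination_by S.card
decreasing_by
  have hT := T.2
  simp only [mem_filter, mem_powerset] at hT
  exact card_lt_card (hT.1.ssubset_of_ne hT.2.2)

/-- Splitting off the term `T = S` of the cumulant recursion. -/
theorem sum_powerset_eq_add {M K : Finset ι → R} (hM : M ∅ = 1) {S : Finset ι} {a : ι}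
    (ha : a ∈ S) :
    ∑ T ∈ S.powerset with a ∈ T, K T * M (S \ T) =
      K S + ∑ T ∈ S.powerset with a ∈ T ∧ T ≠ S, K T * M (S \ T) := by
  have hS : S ∈ S.powerset.filter (a ∈ ·) := by simp [ha]
  rw [← add_sum_erase _ _ hS]
  congr 1
  · simp [hM]
  · refine sum_congr ?_ fun _ _ => rfl
    ext T
    simp only [mem_erase, mem_filter]
    tauto

theorem exists_moment_eq_sum {M : Finset ι → R} (hM : M ∅ = 1) {S : Finset ι}
    (hS : S.Nonempty) :
    ∃ a ∈ S, M S = ∑ T ∈ S.powerset with a ∈ T, combCumulant M T * M (S \ T) := by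
  refine ⟨hS.choose, hS.choose_spec, ?_⟩
  rw [sum_powerset_eq_add hM hS.choose_spec]
  conv_rhs => rw [combCumulant, dif_pos hS]
  rw [sum_attach _ fun T => combCumulant M T * M (S \ T)]
  ring

section

variable [Fintype ι]

/-- The moment-cumulant formula. -/
theorem moment_eq_partitionSum {M : Finset ι → R} (hM : M ∅ = 1) (S : Finset ι) :
    M S = partitionSum (combCumulant M) S := by
  induction S using Finset.strongInduction with
  | H S ih =>
    rcases S.eq_empty_or_nonempty with rfl | hS
    · rw [hM, partitionSum_empty]
    · obtain ⟨a, ha, h⟩ := exists_moment_eq_sum hM hS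
      rw [h, partitionSum_eq_sum _ ha]
      refine sum_congr rfl fun T hT => ?_
      rw [mem_filter, mem_powerset] at hT
      rw [ih (S \ T) (sdiff_ssubset hT.1 ⟨a, hT.2⟩)]

/-- The cumulant recursion, for an arbitrary distinguished element. -/
theorem moment_eq_sum {M : Finset ι → R} (hM : M ∅ = 1) {S : Finset ι} {a : ι} (ha : a ∈ S) :
    M S = ∑ T ∈ S.powerset with a ∈ T, combCumulant M T * M (S \ T) := by
  rw [moment_eq_partitionSum hM, partitionSum_eq_sum _ ha]
  exact sum_congr rfl fun T _ => by rw [moment_eq_partitionSum hM]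

/-- The recursion determines the cumulants; it is needed only for one distinguished element of each
subset. -/
theorem eq_combCumulant_of_subset {M K : Finset ι → R} (hM : M ∅ = 1) {V : Finset ι}
    (h : ∀ S ⊆ V, S.Nonempty →
      ∃ a ∈ S, M S = ∑ T ∈ S.powerset with a ∈ T, K T * M (S \ T))
    {S : Finset ι} (hSV : S ⊆ V) (hS : S.Nonempty) : K S = combCumulant M S := by
  induction S using Finset.strongInduction with
  | H S ih =>
    obtain ⟨a, ha, h1⟩ := h S hSV hS
    have h2 := moment_eq_sum hM ha
    rw [sum_powerset_eq_add hM ha] at h1 h2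
    have h3 : ∑ T ∈ S.powerset with a ∈ T ∧ T ≠ S, K T * M (S \ T) =
        ∑ T ∈ S.powerset with a ∈ T ∧ T ≠ S, combCumulant M T * M (S \ T) := by
      refine sum_congr rfl fun T hT => ?_
      rw [mem_filter, mem_powerset] at hT
      rw [ih T (hT.1.ssubset_of_ne hT.2.2) (hT.1.trans hSV) ⟨a, hT.2.1⟩]
    rw [h1, h3] at h2
    exact add_right_cancel h2

theorem combCumulant_congr {M M' : Finset ι → R} (hM : M ∅ = 1) {S : Finset ι}
    (h : ∀ T ⊆ S, M T = M' T) : combCumulant M S = combCumulant M' S := by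
  have hM' : M' ∅ = 1 := by rw [← h ∅ (empty_subset _), hM]
  rcases S.eq_empty_or_nonempty with rfl | hS
  · rw [combCumulant, combCumulant]; simp
  refine eq_combCumulant_of_subset hM' (V := S) (fun U hU hne => ?_) subset_rfl hS
  obtain ⟨a, ha⟩ := hne
  refine ⟨a, ha, ?_⟩
  rw [← h U hU, moment_eq_sum hM ha]
  refine sum_congr rfl fun T _ => ?_
  rw [h (U \ T) (sdiff_subset.trans hU)]

theorem combCumulant_singleton {M : Finset ι → R} (hM : M ∅ = 1) (a : ι) :
    combCumulant M {a} = M {a} := by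
  have h := moment_eq_sum hM (mem_singleton_self a)
  rw [sum_powerset_eq_add hM (mem_singleton_self a), sum_eq_zero, add_zero] at h
  · exact h.symm
  · intro T hT
    simp only [mem_filter, mem_powerset, subset_singleton_iff] at hT
    rcases hT.1 with rfl | rfl <;> simp at hT

/-- Cumulants vanish if the variables split into two independent groups. -/
theorem combCumulant_eq_zero {M : Finset ι → R} (hM : M ∅ = 1) {V : Finset ι} (U : Finset ι)
    (h : ∀ S ⊆ V, M S = M (S ∩ U) * M (S \ U)) (h1 : (V ∩ U).Nonempty) (h2 : (V \ U).Nonempty) :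
    combCumulant M V = 0 := by
  classical
  -- the cumulants within each group, extended by zero, satisfy the recursion
  let K : Finset ι → R := fun S => if S ⊆ U ∨ Disjoint S U then combCumulant M S else 0
  have hV : V.Nonempty := h1.mono inter_subset_left
  have key : K V = combCumulant M V := by
    refine eq_combCumulant_of_subset hM (V := V) (fun S hS hne => ?_) subset_rfl hV
    obtain ⟨a, ha⟩ := hne
    refine ⟨a, ha, ?_⟩
    by_cases haU : a ∈ U
    · rw [h S hS, moment_eq_sum hM (mem_inter.2 ⟨ha, haU⟩), sum_mul]
      refine sum_subset_zero_on_sdiff (fun T hT => ?_) (fun T hT => ?_) (fun T hT => ?_)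
      · simp only [mem_filter, mem_powerset, subset_inter_iff] at hT ⊢
        exact ⟨hT.1.1, hT.2⟩
      · simp only [mem_sdiff, mem_filter, mem_powerset, subset_inter_iff] at hT
        have : K T = 0 := by
          refine if_neg (not_or.2 ⟨fun hc => hT.2 ⟨⟨hT.1.1, hc⟩, hT.1.2⟩, fun hc => ?_⟩)
          exact disjoint_left.1 hc hT.1.2 haU
        rw [this, zero_mul]
      · simp only [mem_filter, mem_powerset, subset_inter_iff] at hT
        have hK : K T = combCumulant M T := if_pos (Or.inl hT.1.2)
        rw [hK, mul_assoc, h (S \ T) (sdiff_subset.trans hS)]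
        congr 3
        · ext x
          simp only [mem_sdiff, mem_inter]
          tauto
        · ext x
          simp only [mem_sdiff]
          exact ⟨fun hx => ⟨⟨hx.1, fun hc => hx.2 (hT.1.2 hc)⟩, hx.2⟩, fun hx => ⟨hx.1.1, hx.2⟩⟩
    · rw [h S hS, mul_comm, moment_eq_sum hM (mem_sdiff.2 ⟨ha, haU⟩), sum_mul]
      refine sum_subset_zero_on_sdiff (fun T hT => ?_) (fun T hT => ?_) (fun T hT => ?_)
      · simp only [mem_filter, mem_powerset, subset_sdiff] at hT ⊢
        exact ⟨hT.1.1, hT.2⟩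
      · simp only [mem_sdiff, mem_filter, mem_powerset, subset_sdiff] at hT
        have : K T = 0 := by
          refine if_neg (not_or.2 ⟨fun hc => haU (hc hT.1.2), fun hc => ?_⟩)
          exact hT.2 ⟨⟨hT.1.1, hc⟩, hT.1.2⟩
        rw [this, zero_mul]
      · simp only [mem_filter, mem_powerset, subset_sdiff] at hT
        have hK : K T = combCumulant M T := if_pos (Or.inr hT.1.2)
        rw [hK, mul_assoc, h (S \ T) (sdiff_subset.trans hS), mul_comm (M ((S \ T) ∩ U))]
        have hd := hT.1.2
        rw [disjoint_left] at hd
        congr 3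
        · ext x
          simp only [mem_sdiff]
          tauto
        · ext x
          have := @hd x
          simp only [mem_sdiff, mem_inter]
          tauto
  rw [← key]
  obtain ⟨x, hx⟩ := h1
  obtain ⟨y, hy⟩ := h2
  rw [mem_inter] at hx
  rw [mem_sdiff] at hy
  exact if_neg (not_or.2 ⟨fun hc => hy.2 (hc hy.1), fun hc => disjoint_left.1 hc hx.1 hx.2⟩)

/-- The formula of Leonov and Shiryaev: the cumulants of products of variables over blocks are sums
of products of cumulants of the variables over the partitions connecting the blocks. -/
theorem combCumulant_blockUnion [Fintype κ] (β : ι → κ) {M : Finset ι → R} (hM : M ∅ = 1)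
    {S : Finset κ} (hS : S.Nonempty) :
    combCumulant (fun T => M (blockUnion β T)) S = connectedSum β (combCumulant M) S := by
  have h0 : blockUnion β (∅ : Finset κ) = ∅ := by ext; simp
  refine (eq_combCumulant_of_subset (K := connectedSum β (combCumulant M)) (V := S)
    (by rw [h0, hM]) (fun U _ hU => ?_) subset_rfl hS).symm
  obtain ⟨a, ha⟩ := hU
  refine ⟨a, ha, ?_⟩
  rw [moment_eq_partitionSum hM, partitionSum_blockUnion β _ ha]
  exact sum_congr rfl fun T _ => by rw [moment_eq_partitionSum hM (blockUnion β (U \ T))]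

theorem combCumulant_map [Fintype κ] (e : κ ↪ ι) {M : Finset ι → R} (hM : M ∅ = 1)
    {S : Finset κ} (hS : S.Nonempty) :
    combCumulant (fun T => M (T.map e)) S = combCumulant M (S.map e) := by
  refine (eq_combCumulant_of_subset (K := fun T => combCumulant M (T.map e)) (V := S)
    (by simpa using hM) (fun U _ hU => ?_) subset_rfl hS).symm
  obtain ⟨a, ha⟩ := hU
  refine ⟨a, ha, ?_⟩
  rw [moment_eq_sum hM (mem_map_of_mem e ha)]
  symm
  refine sum_bij (fun T _ => T.map e) (fun T hT => ?_) (fun T _ T' _ h => map_injective e h)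
    (fun T hT => ?_) (fun T hT => ?_)
  · simp only [mem_filter, mem_powerset] at hT ⊢
    exact ⟨map_subset_map.2 hT.1, mem_map_of_mem e hT.2⟩
  · simp only [mem_filter, mem_powerset] at hT
    obtain ⟨T', hT', rfl⟩ := subset_map_iff.1 hT.1
    refine ⟨T', ?_, rfl⟩
    simp only [mem_filter, mem_powerset]
    exact ⟨hT', by simpa using hT.2⟩
  · rw [Finset.map_sdiff]

end

end Cumulants

/-! ### Iterated directional derivatives and the Leibniz rule -/

section DirectionalDerivatives

open Filter Topology Finset
open scoped ContDiff

variable {V : Type*} [NormedAddCommGroup V] [NormedSpace ℝ V]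

/-- The iterated directional derivative along the vectors of a list, the derivative along the head
being taken first. -/
noncomputable def dirDeriv : List V → (V → ℂ) → V → ℂ
  | [], f => f
  | v :: l, f => dirDeriv l fun y => fderiv ℝ f y v

theorem Filter.EventuallyEq.dirDeriv {f g : V → ℂ} {x : V} (h : f =ᶠ[𝓝 x] g) (l : List V) :
    dirDeriv l f =ᶠ[𝓝 x] dirDeriv l g := by
  induction l generalizing f g with
  | nil => exact h
  | cons v l ih => exact ih ((h.fderiv (𝕜 := ℝ)).mono fun y hy => by simp only [hy])

theorem ContDiffAt.fderiv_apply_const {f : V → ℂ} {x : V} (hf : ContDiffAt ℝ ∞ f x) (v : V) :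
    ContDiffAt ℝ ∞ (fun y => fderiv ℝ f y v) x :=
  (hf.fderiv_right (m := ∞) (by simp)).clm_apply contDiffAt_const

theorem ContDiffAt.eventually_differentiableAt {f : V → ℂ} {x : V} (hf : ContDiffAt ℝ ∞ f x) :
    ∀ᶠ y in 𝓝 x, DifferentiableAt ℝ f y :=
  ((hf.of_le (m := 1) (by exact_mod_cast le_top)).eventually (by simp)).mono fun _ hy =>
    hy.differentiableAt (by simp)

theorem dirDeriv_add {f g : V → ℂ} {x : V} (hf : ContDiffAt ℝ ∞ f x) (hg : ContDiffAt ℝ ∞ g x)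
    (l : List V) :
    dirDeriv l (fun y => f y + g y) x = dirDeriv l f x + dirDeriv l g x := by
  induction l generalizing f g with
  | nil => rfl
  | cons v l ih =>
    simp only [dirDeriv]
    rw [← ih (hf.fderiv_apply_const v) (hg.fderiv_apply_const v)]
    refine (EventuallyEq.dirDeriv ?_ l).eq_of_nhds
    filter_upwards [hf.eventually_differentiableAt, hg.eventually_differentiableAt] with y h1 h2
    rw [fderiv_fun_add h1 h2]
    rfl

theorem iteratedFDeriv_eq_dirDeriv {f : V → ℂ} {x : V} (hf : ContDiffAt ℝ ∞ f x) {n : ℕ}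
    (v : Fin n → V) : iteratedFDeriv ℝ n f x v = dirDeriv (List.ofFn v).reverse f x := by
  induction n generalizing f with
  | zero => simp [dirDeriv]
  | succ n ih =>
    rw [List.ofFn_succ', List.concat_eq_append, List.reverse_append, iteratedFDeriv_succ_apply_right]
    simp only [List.reverse_singleton, List.singleton_append, dirDeriv]
    rw [← ih (hf.fderiv_apply_const (v (Fin.last n)))]
    have h := (ContinuousLinearMap.apply ℝ ℂ (v (Fin.last n))).iteratedFDeriv_comp_left
      (hf.fderiv_right (m := ∞) (by simp)) (i := n) (by exact_mod_cast le_top)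
    have h' := congrArg (fun m => m (Fin.init v)) h
    exact h'.symm

variable {ι : Type*} [LinearOrder ι]

/-- The mixed partial derivative along the vectors `e i`, `i ∈ S`; the derivatives are taken in
decreasing order of `i`, which avoids any appeal to the symmetry of second derivatives. -/
noncomputable def mixedDeriv (e : ι → V) (S : Finset ι) (f : V → ℂ) (x : V) : ℂ :=
  dirDeriv ((S.sort (· ≥ ·)).map e) f x

@[simp] theorem mixedDeriv_empty (e : ι → V) (f : V → ℂ) (x : V) : mixedDeriv e ∅ f x = f x := by
  simp [mixedDeriv, dirDeriv]

theorem mixedDeriv_insert (e : ι → V) {S : Finset ι} {a : ι} (ha : ∀ b ∈ S, b < a) (f : V → ℂ)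
    (x : V) :
    mixedDeriv e (insert a S) f x = mixedDeriv e S (fun y => fderiv ℝ f y (e a)) x := by
  rw [mixedDeriv, Finset.sort_insert (· ≥ ·) (fun b hb => (ha b hb).le)
    (fun h => lt_irrefl _ (ha a h))]
  rfl

theorem mixedDeriv_congr (e : ι → V) (S : Finset ι) {f g : V → ℂ} {x : V} (h : f =ᶠ[𝓝 x] g) :
    mixedDeriv e S f x = mixedDeriv e S g x :=
  (h.dirDeriv _).eq_of_nhds

/-- The Leibniz rule. -/
theorem mixedDeriv_mul (e : ι → V) (S : Finset ι) {f g : V → ℂ} {x : V}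
    (hf : ContDiffAt ℝ ∞ f x) (hg : ContDiffAt ℝ ∞ g x) :
    mixedDeriv e S (fun y => f y * g y) x =
      ∑ T ∈ S.powerset, mixedDeriv e T f x * mixedDeriv e (S \ T) g x := by
  induction S using Finset.induction_on_max generalizing f g with
  | empty => simp
  | insert a S ha ih =>
    have haS : a ∉ S := fun h => lt_irrefl _ (ha a h)
    have h1 : mixedDeriv e S (fun y => fderiv ℝ (fun y => f y * g y) y (e a)) x =
        mixedDeriv e S (fun y => f y * fderiv ℝ g y (e a)) x +
          mixedDeriv e S (fun y => fderiv ℝ f y (e a) * g y) x := by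
      rw [mixedDeriv, mixedDeriv, mixedDeriv, ← dirDeriv_add (hf.mul (hg.fderiv_apply_const _))
        ((hf.fderiv_apply_const _).mul hg)]
      refine mixedDeriv_congr e S ?_
      filter_upwards [hf.eventually_differentiableAt, hg.eventually_differentiableAt] with y h1 h2
      rw [fderiv_fun_mul h1 h2]
      simp [mul_comm]
    rw [mixedDeriv_insert e ha, h1, ih hf (hg.fderiv_apply_const _),
      ih (hf.fderiv_apply_const _) hg, sum_powerset_insert haS]
    congr 1
    · refine sum_congr rfl fun T hT => ?_
      rw [mem_powerset] at hT
      rw [insert_sdiff_of_notMem _ fun h => haS (hT h),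
        mixedDeriv_insert e fun b hb => ha b (mem_sdiff.1 hb).1]
    · refine sum_congr rfl fun T hT => ?_
      rw [mem_powerset] at hT
      rw [mixedDeriv_insert e fun b hb => ha b (hT hb), insert_sdiff_insert,
        sdiff_insert_of_notMem haS]

/-- Differentiating `φ' = (log φ)' φ` turns the mixed derivatives of `log φ` into cumulants of those
of `φ`. -/
theorem mixedDeriv_log [Fintype ι] (e : ι → V) {f : V → ℂ} {x : V} (hf : ContDiffAt ℝ ∞ f x)
    (hfx : f x = 1) {S : Finset ι} (hS : S.Nonempty) :
    mixedDeriv e S (fun y => Complex.log (f y)) x =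
      combCumulant (fun T => mixedDeriv e T f x) S := by
  have hslit : f x ∈ Complex.slitPlane := by simp [hfx]
  have hlog : ContDiffAt ℝ ∞ (fun y => Complex.log (f y)) x :=
    ((Complex.contDiffAt_log hslit).restrict_scalars ℝ).comp x hf
  have hmem : ∀ᶠ y in 𝓝 x, f y ∈ Complex.slitPlane :=
    hf.continuousAt.eventually_mem (Complex.isOpen_slitPlane.mem_nhds hslit)
  refine eq_combCumulant_of_subset (K := fun S => mixedDeriv e S (fun y => Complex.log (f y)) x)
    (V := S) (by simpa using hfx) (fun U _ hU => ?_) subset_rfl hS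
  -- the largest index is the direction of the first derivative, hence the distinguished one
  refine ⟨U.max' hU, U.max'_mem hU, ?_⟩
  obtain ⟨a, W, haW, hW, rfl⟩ : ∃ a W, a = U.max' hU ∧ (∀ b ∈ W, b < a) ∧ insert a W = U :=
    ⟨U.max' hU, U.erase (U.max' hU), rfl, fun b hb =>
      lt_of_le_of_ne (U.le_max' b (mem_of_mem_erase hb)) (ne_of_mem_erase hb),
      insert_erase (U.max'_mem hU)⟩
  rw [← haW]
  have haW' : a ∉ W := fun h => lt_irrefl _ (hW a h)
  have hderiv : (fun y => fderiv ℝ f y (e a)) =ᶠ[𝓝 x]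
      fun y => fderiv ℝ (fun y => Complex.log (f y)) y (e a) * f y := by
    filter_upwards [hf.eventually_differentiableAt, hmem] with y h1 h2
    have h3 := ((Complex.hasStrictDerivAt_log h2).hasDerivAt.hasFDerivAt.restrictScalars ℝ).comp y
      h1.hasFDerivAt
    have h4 : f y ≠ 0 := Complex.slitPlane_ne_zero h2
    have h5 : fderiv ℝ (fun y => Complex.log (f y)) y (e a) = fderiv ℝ f y (e a) * (f y)⁻¹ := by
      rw [show (fun y => Complex.log (f y)) = Complex.log ∘ f from rfl, h3.fderiv]
      simp
    rw [h5]
    field_simp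
  have hfilter : (insert a W).powerset.filter (a ∈ ·) = W.powerset.image (insert a) := by
    ext T
    simp only [mem_filter, mem_powerset, mem_image]
    constructor
    · rintro ⟨h1, h2⟩
      exact ⟨T.erase a, by rwa [← subset_insert_iff], insert_erase h2⟩
    · rintro ⟨T, hT, rfl⟩
      exact ⟨insert_subset_insert a hT, mem_insert_self a T⟩
  rw [mixedDeriv_insert e hW, mixedDeriv_congr e W hderiv,
    mixedDeriv_mul e W (hlog.fderiv_apply_const _) hf, hfilter, sum_image]
  · refine sum_congr rfl fun T hT => ?_
    rw [mem_powerset] at hT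
    rw [mixedDeriv_insert e fun b hb => hW b (hT hb), insert_sdiff_insert,
      sdiff_insert_of_notMem haW']
  · intro T hT T' hT' h
    rw [mem_coe, mem_powerset] at hT hT'
    rw [← erase_insert (fun hc => haW' (hT hc)), h, erase_insert (fun hc => haW' (hT' hc))]

end DirectionalDerivatives

/-! ### Joint cumulants of random variables with moments of all orders -/

section JointCumulants

open Finset Filter Topology

variable {Ω : Type*}

/-- The exponential in the characteristic function has modulus one. -/
theorem norm_charFun_kernel {r : ℕ} (X : Fin r → Ω → ℝ) (t : Fin r → ℝ) (ω : Ω) :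
    ‖Complex.exp (∑ j, Complex.I * (t j : ℂ) * (X j ω : ℂ))‖ = 1 := by
  have : ∑ j, Complex.I * (t j : ℂ) * (X j ω : ℂ) = ((∑ j, t j * X j ω : ℝ) : ℂ) * Complex.I := by
    push_cast
    rw [sum_mul]
    exact sum_congr rfl fun j _ => by ring
  rw [this, Complex.norm_exp_ofReal_mul_I]

/-- The real-linear map `t ↦ tⱼ z`, as a continuous linear function of `z`. -/
noncomputable def coordSmul {r : ℕ} (j : Fin r) : ℂ →L[ℝ] (Fin r → ℝ) →L[ℝ] ℂ :=
  ContinuousLinearMap.smulRightL ℝ (Fin r → ℝ) ℂ (ContinuousLinearMap.proj j)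

@[simp] theorem coordSmul_apply {r : ℕ} (j : Fin r) (z : ℂ) (t : Fin r → ℝ) :
    coordSmul j z t = t j * z := by
  change t j • z = _
  rw [Complex.real_smul]

theorem hasFDerivAt_charFun_kernel {r : ℕ} (X : Fin r → Ω → ℝ) (h : Ω → ℂ) (ω : Ω)
    (t : Fin r → ℝ) :
    HasFDerivAt
      (fun t : Fin r → ℝ => h ω * Complex.exp (∑ j, Complex.I * (t j : ℂ) * (X j ω : ℂ)))
      (∑ j, coordSmul j (h ω * (Complex.I * (X j ω : ℂ)) *
        Complex.exp (∑ j, Complex.I * (t j : ℂ) * (X j ω : ℂ)))) t := by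
  have h1 : HasFDerivAt (fun t : Fin r → ℝ => ∑ j, Complex.I * (t j : ℂ) * (X j ω : ℂ))
      (∑ j, coordSmul j (Complex.I * (X j ω : ℂ))) t := by
    refine HasFDerivAt.fun_sum fun j _ => ?_
    refine (coordSmul j (Complex.I * (X j ω : ℂ))).hasFDerivAt.congr_of_eventuallyEq
      (Eventually.of_forall fun s => ?_)
    simp only [coordSmul_apply]
    ring
  refine (h1.cexp.const_mul (h ω)).congr_fderiv ?_
  ext v
  simp only [_root_.smul_apply, _root_.sum_apply, coordSmul_apply, smul_eq_mul,
    mul_sum]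
  exact sum_congr rfl fun j _ => by ring

variable [MeasurableSpace Ω] {μ : Measure Ω}

/-- All absolute moments of `f` are finite; the case `q = 0` of `MemLp` says that `f` is
a.e. strongly measurable. -/
def HasAllMoments {𝕜 : Type*} [RCLike 𝕜] (f : Ω → 𝕜) (μ : Measure Ω) : Prop :=
  ∀ q : ℕ, MemLp f q μ

section

variable {𝕜 : Type*} [RCLike 𝕜] {f g : Ω → 𝕜}

/-- Products stay in the class by the inequality of Cauchy and Schwarz, `1/(2q) + 1/(2q) = 1/q`. -/
theorem HasAllMoments.mul (hf : HasAllMoments f μ) (hg : HasAllMoments g μ) :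
    HasAllMoments (fun ω => f ω * g ω) μ := by
  intro q
  have : ENNReal.HolderTriple ((2 * q : ℕ) : ENNReal) ((2 * q : ℕ) : ENNReal) (q : ENNReal) := by
    constructor
    push_cast
    rw [ENNReal.mul_inv (by simp) (by simp), ← two_mul, ← mul_assoc,
      ENNReal.mul_inv_cancel (by simp) (by simp), one_mul]
  exact (hg (2 * q)).mul (hf (2 * q))

theorem HasAllMoments.integrable (hf : HasAllMoments f μ) : Integrable f μ :=
  memLp_one_iff_integrable.1 (by exact_mod_cast hf 1)

theorem HasAllMoments.const [IsFiniteMeasure μ] (c : 𝕜) : HasAllMoments (fun _ : Ω => c) μ :=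
  fun _ => memLp_const c

theorem HasAllMoments.add (hf : HasAllMoments f μ) (hg : HasAllMoments g μ) :
    HasAllMoments (fun ω => f ω + g ω) μ := fun q => (hf q).add (hg q)

theorem HasAllMoments.prod [IsFiniteMeasure μ] {ι : Type*} {f : ι → Ω → 𝕜}
    (S : Finset ι) (hf : ∀ i ∈ S, HasAllMoments (f i) μ) :
    HasAllMoments (fun ω => ∏ i ∈ S, f i ω) μ := by
  classical
  induction S using Finset.induction_on with
  | empty => simpa using HasAllMoments.const 1
  | insert a S ha ih =>
    simp only [prod_insert ha]
    exact (hf a (mem_insert_self a S)).mul (ih fun i hi => hf i (mem_insert_of_mem hi))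

end

variable {r : ℕ}

/-- The weighted characteristic function `t ↦ E (h exp (∑ⱼ i tⱼ Xⱼ))`. -/
noncomputable def weightedCharFun (μ : Measure Ω) (X : Fin r → Ω → ℝ) (h : Ω → ℂ)
    (t : Fin r → ℝ) : ℂ :=
  ∫ ω, h ω * Complex.exp (∑ j, Complex.I * (t j : ℂ) * (X j ω : ℂ)) ∂μ

theorem HasAllMoments.mul_I_mul {X : Ω → ℝ} (hX : HasAllMoments X μ) {h : Ω → ℂ}
    (hh : HasAllMoments h μ) : HasAllMoments (fun ω => h ω * (Complex.I * (X ω : ℂ))) μ :=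
  hh.mul fun q => (hX q).ofReal.const_mul Complex.I

theorem aestronglyMeasurable_charFun_kernel {X : Fin r → Ω → ℝ}
    (hX : ∀ j, HasAllMoments (X j) μ) (t : Fin r → ℝ) :
    AEStronglyMeasurable
      (fun ω => Complex.exp (∑ j, Complex.I * (t j : ℂ) * (X j ω : ℂ))) μ := by
  refine Complex.continuous_exp.comp_aestronglyMeasurable ?_
  refine Finset.aestronglyMeasurable_fun_sum _ fun j _ => ?_
  exact ((hX j 0).ofReal.aestronglyMeasurable).const_mul _

theorem integrable_weightedCharFun {X : Fin r → Ω → ℝ} (hX : ∀ j, HasAllMoments (X j) μ)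
    {h : Ω → ℂ} (hh : HasAllMoments h μ) (t : Fin r → ℝ) :
    Integrable (fun ω => h ω * Complex.exp (∑ j, Complex.I * (t j : ℂ) * (X j ω : ℂ))) μ := by
  refine hh.integrable.mono (hh.integrable.aestronglyMeasurable.mul
    (aestronglyMeasurable_charFun_kernel hX t)) (ae_of_all _ fun ω => ?_)
  rw [norm_mul, norm_charFun_kernel, mul_one]

/-- For `G` a space of linear maps, unifying the instances in `integrable_finsetSum` directly is
prohibitively slow. -/
theorem integrable_fintype_sum {ι G : Type*} [Fintype ι] [NormedAddCommGroup G]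
    {F : ι → Ω → G} (hF : ∀ j, Integrable (F j) μ) : Integrable (fun ω => ∑ j, F j ω) μ :=
  integrable_finsetSum _ fun j _ => hF j

theorem hasFDerivAt_weightedCharFun {X : Fin r → Ω → ℝ} (hX : ∀ j, HasAllMoments (X j) μ)
    {h : Ω → ℂ} (hh : HasAllMoments h μ) (t : Fin r → ℝ) :
    HasFDerivAt (weightedCharFun μ X h)
      (∑ j, coordSmul j (weightedCharFun μ X (fun ω => h ω * (Complex.I * (X j ω : ℂ))) t)) t := by
  have hint0 : ∀ j, Integrable (fun ω => h ω * (Complex.I * (X j ω : ℂ)) *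
      Complex.exp (∑ j, Complex.I * (t j : ℂ) * (X j ω : ℂ))) μ := fun j =>
    integrable_weightedCharFun hX ((hX j).mul_I_mul hh) t
  have hint : Integrable (fun ω => ∑ j, coordSmul j (h ω * (Complex.I * (X j ω : ℂ)) *
      Complex.exp (∑ j, Complex.I * (t j : ℂ) * (X j ω : ℂ)))) μ :=
    integrable_fintype_sum fun j => (coordSmul j).integrable_comp (hint0 j)
  have key := hasFDerivAt_integral_of_dominated_of_fderiv_le (𝕜 := ℝ) (s := Set.univ) (μ := μ)
    (x₀ := t)
    (F := fun t ω => h ω * Complex.exp (∑ j, Complex.I * (t j : ℂ) * (X j ω : ℂ)))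
    (F' := fun t ω => ∑ j, coordSmul j (h ω * (Complex.I * (X j ω : ℂ)) *
        Complex.exp (∑ j, Complex.I * (t j : ℂ) * (X j ω : ℂ))))
    (bound := fun ω => ∑ j, ‖(coordSmul j : ℂ →L[ℝ] (Fin r → ℝ) →L[ℝ] ℂ)‖ *
      ‖h ω * (Complex.I * (X j ω : ℂ))‖)
    univ_mem
    (Eventually.of_forall fun t => (integrable_weightedCharFun hX hh t).aestronglyMeasurable)
    (integrable_weightedCharFun hX hh t) hint.aestronglyMeasurable
    (ae_of_all _ fun ω t _ => (norm_sum_le _ _).trans (sum_le_sum fun j _ => by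
      refine ((coordSmul j).le_opNorm _).trans_eq ?_
      rw [norm_mul _ (Complex.exp _), norm_charFun_kernel, mul_one]))
    (integrable_finsetSum _ fun j _ => (((hX j).mul_I_mul hh).integrable.norm).const_mul _)
    (ae_of_all _ fun ω t _ => hasFDerivAt_charFun_kernel X h ω t)
  refine key.congr_fderiv ?_
  rw [integral_finsetSum _ fun j _ => (coordSmul j).integrable_comp (hint0 j)]
  exact sum_congr rfl fun j _ => (coordSmul j).integral_comp_comm (hint0 j)

theorem contDiff_weightedCharFun {X : Fin r → Ω → ℝ} (hX : ∀ j, HasAllMoments (X j) μ)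
    {h : Ω → ℂ} (hh : HasAllMoments h μ) : ContDiff ℝ (⊤ : ℕ∞) (weightedCharFun μ X h) := by
  rw [contDiff_infty]
  intro n
  induction n generalizing h with
  | zero =>
    exact contDiff_zero.2 (continuous_iff_continuousAt.2 fun t =>
      (hasFDerivAt_weightedCharFun hX hh t).continuousAt)
  | succ n ih =>
    rw [Nat.cast_succ, contDiff_succ_iff_fderiv]
    refine ⟨fun t => (hasFDerivAt_weightedCharFun hX hh t).differentiableAt,
      fun h => absurd h (by simp), ?_⟩
    rw [show fderiv ℝ (weightedCharFun μ X h) = fun t => ∑ j,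
        coordSmul j (weightedCharFun μ X (fun ω => h ω * (Complex.I * (X j ω : ℂ))) t) from
      funext fun t => (hasFDerivAt_weightedCharFun hX hh t).fderiv]
    exact ContDiff.sum fun j _ => (coordSmul j).contDiff.comp (ih ((hX j).mul_I_mul hh))

theorem fderiv_weightedCharFun_single {X : Fin r → Ω → ℝ} (hX : ∀ j, HasAllMoments (X j) μ)
    {h : Ω → ℂ} (hh : HasAllMoments h μ) (a : Fin r) (t : Fin r → ℝ) :
    fderiv ℝ (weightedCharFun μ X h) t (Pi.single a 1) =
      weightedCharFun μ X (fun ω => h ω * (Complex.I * (X a ω : ℂ))) t := by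
  rw [(hasFDerivAt_weightedCharFun hX hh t).fderiv, _root_.sum_apply,
    sum_eq_single a]
  · simp
  · intro j _ hj
    simp [hj]
  · simp

/-- Differentiation along the coordinate `j` multiplies the weight by `i Xⱼ`. -/
theorem mixedDeriv_weightedCharFun {X : Fin r → Ω → ℝ} (hX : ∀ j, HasAllMoments (X j) μ)
    {h : Ω → ℂ} (hh : HasAllMoments h μ) (S : Finset (Fin r)) (t : Fin r → ℝ) :
    mixedDeriv (fun j : Fin r => (Pi.single j 1 : Fin r → ℝ)) S (weightedCharFun μ X h) t =
      weightedCharFun μ X (fun ω => h ω * ∏ j ∈ S, (Complex.I * (X j ω : ℂ))) t := by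
  induction S using Finset.induction_on_max generalizing h with
  | empty => simp
  | insert a S ha ih =>
    have haS : a ∉ S := fun h => lt_irrefl _ (ha a h)
    rw [mixedDeriv_insert _ ha]
    simp only [fderiv_weightedCharFun_single hX hh]
    rw [ih ((hX a).mul_I_mul hh)]
    congr 1
    funext ω
    rw [prod_insert haS, mul_assoc]

/-- The mean of the product of the variables with index in `S`. -/
noncomputable def jointMoment (μ : Measure Ω) {ι : Type*} (X : ι → Ω → ℝ) (S : Finset ι) : ℂ :=
  ((∫ ω, ∏ i ∈ S, X i ω ∂μ : ℝ) : ℂ)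

theorem jointMoment_empty [IsProbabilityMeasure μ] {ι : Type*} (X : ι → Ω → ℝ) :
    jointMoment μ X ∅ = 1 := by simp [jointMoment]

/-- Homogeneity of cumulants. -/
theorem combCumulant_pow_mul {ι : Type*} [Fintype ι] [DecidableEq ι] {M : Finset ι → ℂ}
    (hM : M ∅ = 1) (c : ℂ) {S : Finset ι} (hS : S.Nonempty) :
    combCumulant (fun T => c ^ T.card * M T) S = c ^ S.card * combCumulant M S := by
  refine (eq_combCumulant_of_subset (K := fun T => c ^ T.card * combCumulant M T) (V := S)
    (by simpa using hM) (fun U _ hU => ?_) subset_rfl hS).symm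
  obtain ⟨a, ha⟩ := hU
  refine ⟨a, ha, ?_⟩
  rw [moment_eq_sum hM ha, mul_sum]
  refine sum_congr rfl fun T hT => ?_
  have hT : T ⊆ U := mem_powerset.1 (mem_filter.1 hT).1
  rw [← card_sdiff_add_card_eq_card hT, pow_add]
  ring

/-- The analytically defined joint cumulant is the combinatorial one. -/
theorem jointCumulant_eq_combCumulant [IsProbabilityMeasure μ] {X : Fin r → Ω → ℝ} (hr : 0 < r)
    (hX : ∀ j, HasAllMoments (X j) μ) :
    jointCumulant μ X = combCumulant (jointMoment μ X) univ := by
  have hne : (univ : Finset (Fin r)).Nonempty := ⟨⟨0, hr⟩, mem_univ _⟩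
  have h1 : HasAllMoments (fun _ : Ω => (1 : ℂ)) μ := HasAllMoments.const 1
  have hΦ : jointCharFun μ X = weightedCharFun μ X fun _ => 1 := by
    funext t
    simp [jointCharFun, weightedCharFun]
  have hsm : ContDiffAt ℝ (⊤ : ℕ∞) (jointCharFun μ X) 0 := by
    rw [hΦ]
    exact (contDiff_weightedCharFun hX h1).contDiffAt
  have h0 : jointCharFun μ X 0 = 1 := by simp [jointCharFun]
  have hlog : ContDiffAt ℝ (⊤ : ℕ∞) (fun t => Complex.log (jointCharFun μ X t)) 0 :=
    ((Complex.contDiffAt_log (by simp [h0])).restrict_scalars ℝ).comp 0 hsm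
  have hmoment : ∀ T : Finset (Fin r),
      mixedDeriv (fun j : Fin r => (Pi.single j 1 : Fin r → ℝ)) T (jointCharFun μ X) 0 =
        Complex.I ^ T.card * jointMoment μ X T := by
    intro T
    rw [hΦ, mixedDeriv_weightedCharFun hX h1, weightedCharFun, jointMoment,
      ← integral_complex_ofReal, ← integral_const_mul]
    refine integral_congr_ae (ae_of_all _ fun ω => ?_)
    simp [prod_mul_distrib]
  have hlist : (List.ofFn fun j : Fin r => (Pi.single j 1 : Fin r → ℝ)).reverse =
      ((univ : Finset (Fin r)).sort (· ≥ ·)).map fun j : Fin r => (Pi.single j 1 : Fin r → ℝ) := by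
    have : (univ : Finset (Fin r)).sort (· ≥ ·) = (List.finRange r).reverse := by
      exact (Finset.sortedGT_sort _).eq_of_mem_iff
        (List.sortedLT_finRange r).reverse (by simp)
    rw [this, List.map_reverse, List.ofFn_eq_map]
  have hmix := mixedDeriv_log (fun j : Fin r => (Pi.single j 1 : Fin r → ℝ)) hsm h0 hne
  rw [jointCumulant, iteratedFDeriv_eq_dirDeriv hlog, hlist]
  rw [mixedDeriv] at hmix
  rw [hmix]
  simp only [hmoment]
  rw [combCumulant_pow_mul (jointMoment_empty X) _ hne, card_univ, Fintype.card_fin,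
    inv_mul_cancel_left₀ (pow_ne_zero _ Complex.I_ne_zero)]

end JointCumulants

/-! ### Multilinearity of cumulants -/

section Multilinear

open Finset

variable {A : Type*} [CommRing A] [Algebra ℝ A] {ι : Type*} [Fintype ι] [DecidableEq ι]

/-- Linearity in one variable: the recursion with that variable as distinguished element is linear
in it. -/
theorem combCumulant_update_smul_add (E : A →ₗ[ℝ] ℂ) (hE : E 1 = 1) (u : ι → A) (i : ι) (c : ℝ)
    (x y : A) {S : Finset ι} (hi : i ∈ S) :
    combCumulant (fun T => E (∏ j ∈ T, Function.update u i (c • x + y) j)) S =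
      c * combCumulant (fun T => E (∏ j ∈ T, Function.update u i x j)) S +
        combCumulant (fun T => E (∏ j ∈ T, Function.update u i y j)) S := by
  induction S using Finset.strongInduction with
  | H S ih =>
    have hM : ∀ z, E (∏ j ∈ ∅, Function.update u i z j) = 1 := fun z => by simpa using hE
    have hrec : ∀ z, E (∏ j ∈ S, Function.update u i z j) = _ := fun z =>
      (moment_eq_sum (M := fun T => E (∏ j ∈ T, Function.update u i z j)) (hM z) hi).trans
        (sum_powerset_eq_add (M := fun T => E (∏ j ∈ T, Function.update u i z j))
          (K := combCumulant fun T => E (∏ j ∈ T, Function.update u i z j)) (hM z) hi)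
    have hlin : E (∏ j ∈ S, Function.update u i (c • x + y) j) =
        c * E (∏ j ∈ S, Function.update u i x j) + E (∏ j ∈ S, Function.update u i y j) := by
      simp only [prod_update_of_mem hi, add_mul, map_add, smul_mul_assoc, map_smul,
        Complex.real_smul]
    have hconst : ∀ z, ∀ T ∈ S.powerset.filter (fun T => i ∈ T ∧ T ≠ S),
        E (∏ j ∈ S \ T, Function.update u i z j) = E (∏ j ∈ S \ T, u j) := by
      intro z T hT
      rw [mem_filter] at hT
      rw [prod_update_of_notMem fun h => (mem_sdiff.1 h).2 hT.2.1]
    have hsum : ∑ T ∈ S.powerset with i ∈ T ∧ T ≠ S,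
        combCumulant (fun T => E (∏ j ∈ T, Function.update u i (c • x + y) j)) T *
          E (∏ j ∈ S \ T, Function.update u i (c • x + y) j) =
        c * (∑ T ∈ S.powerset with i ∈ T ∧ T ≠ S,
          combCumulant (fun T => E (∏ j ∈ T, Function.update u i x j)) T *
            E (∏ j ∈ S \ T, Function.update u i x j)) +
        ∑ T ∈ S.powerset with i ∈ T ∧ T ≠ S,
          combCumulant (fun T => E (∏ j ∈ T, Function.update u i y j)) T *
            E (∏ j ∈ S \ T, Function.update u i y j) := by
      rw [mul_sum, ← sum_add_distrib]
      refine sum_congr rfl fun T hT => ?_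
      rw [hconst _ T hT, hconst _ T hT, hconst _ T hT]
      rw [mem_filter, mem_powerset] at hT
      rw [ih T (hT.1.ssubset_of_ne hT.2.2) hT.2.1]
      ring
    rw [hrec, hrec, hrec, hsum] at hlin
    linear_combination hlin

/-- The joint cumulant with respect to a unital functional `E`, as a multilinear map. -/
noncomputable def cumulantMap (ι : Type*) [Fintype ι] [DecidableEq ι] (E : A →ₗ[ℝ] ℂ)
    (hE : E 1 = 1) : MultilinearMap ℝ (fun _ : ι => A) ℂ where
  toFun u := combCumulant (fun T => E (∏ j ∈ T, u j)) univ
  map_update_add' u i x y := by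
    have h := combCumulant_update_smul_add E hE u i 1 x y (mem_univ i)
    simp only [one_smul, Complex.ofReal_one, one_mul] at h
    convert h
  map_update_smul' u i c x := by
    have h0 := combCumulant_update_smul_add E hE u i 1 0 0 (mem_univ i)
    simp only [one_smul, Complex.ofReal_one, one_mul, add_zero, left_eq_add] at h0
    have h := combCumulant_update_smul_add E hE u i c x 0 (mem_univ i)
    -- `h0` says that the cumulant vanishes when one variable is zero
    rw [h0] at h
    simp only [add_zero] at h
    rw [Complex.real_smul]
    convert h

theorem cumulantMap_apply (E : A →ₗ[ℝ] ℂ) (hE : E 1 = 1) (u : ι → A) :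
    cumulantMap ι E hE u = combCumulant (fun T => E (∏ j ∈ T, u j)) univ := rfl

end Multilinear

/-! ### Random variables with moments of all orders -/

section MomentAlgebra

open Finset

variable {Ω : Type*} [MeasurableSpace Ω]

/-- The algebra of real random variables with moments of all orders. -/
def momentAlgebra (μ : Measure Ω) [IsFiniteMeasure μ] : Subalgebra ℝ (Ω → ℝ) where
  carrier := {f | HasAllMoments f μ}
  mul_mem' hf hg := HasAllMoments.mul hf hg
  add_mem' hf hg := HasAllMoments.add hf hg
  algebraMap_mem' c := HasAllMoments.const c

variable (μ : Measure Ω)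

/-- The mean, as a linear functional with complex values. -/
noncomputable def meanFunctional [IsFiniteMeasure μ] : momentAlgebra μ →ₗ[ℝ] ℂ where
  toFun f := ((∫ ω, f.1 ω ∂μ : ℝ) : ℂ)
  map_add' f g := by
    rw [← Complex.ofReal_add, ← integral_add f.2.integrable g.2.integrable]
    rfl
  map_smul' c f := by
    rw [RingHom.id_apply, Complex.real_smul, ← Complex.ofReal_mul, ← integral_const_mul]
    rfl

theorem meanFunctional_one [IsProbabilityMeasure μ] : meanFunctional μ 1 = 1 := by
  simp [meanFunctional]

theorem meanFunctional_prod [IsFiniteMeasure μ] {ι : Type*} (u : ι → momentAlgebra μ)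
    (S : Finset ι) :
    meanFunctional μ (∏ i ∈ S, u i) = jointMoment μ (fun i => (u i : Ω → ℝ)) S := by
  simp only [meanFunctional, jointMoment, LinearMap.coe_mk, AddHom.coe_mk]
  congr 2
  funext ω
  rw [← Finset.prod_apply, ← SubmonoidClass.coe_finsetProd]

theorem HasAllMoments.of_integrable_pow {f : Ω → ℝ} {μ : Measure Ω}
    (hf : AEStronglyMeasurable f μ) (h : ∀ q : ℕ, 1 ≤ q → Integrable (fun ω => |f ω| ^ q) μ) :
    HasAllMoments f μ := by
  intro q
  rcases Nat.eq_zero_or_pos q with rfl | hq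
  · simpa using hf
  · rw [← integrable_norm_rpow_iff hf (by exact_mod_cast hq.ne') (ENNReal.natCast_ne_top q)]
    simpa using h q hq

theorem HasAllMoments.of_identDistrib {Ω' : Type*} [MeasurableSpace Ω'] {μ : Measure Ω}
    {ν : Measure Ω'} {f : Ω → ℝ} {g : Ω' → ℝ} (h : IdentDistrib f g μ ν)
    (hg : HasAllMoments g ν) : HasAllMoments f μ := fun q => h.memLp_iff.2 (hg q)

/-- Moments of a vector indexed by `ℤ` depend only on its law. -/
theorem jointMoment_eq_of_identDistrib {Ω' : Type*} [MeasurableSpace Ω'] {μ : Measure Ω}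
    {ν : Measure Ω'} {X : ℤ → Ω → ℝ} {Y : ℤ → Ω' → ℝ}
    (h : IdentDistrib (fun ω j => X j ω) (fun ω j => Y j ω) μ ν) {ι : Type*} (w : ι → ℤ)
    (S : Finset ι) :
    jointMoment μ (fun a => X (w a)) S = jointMoment ν (fun a => Y (w a)) S := by
  have hm : Measurable fun x : ℤ → ℝ => ∏ a ∈ S, x (w a) :=
    Finset.measurable_fun_prod S fun a _ => measurable_pi_apply (w a)
  exact congrArg _ (h.comp hm).integral_eq

/-- Factorization of the moments of variables taken from independent rows, when one row is
separated from the others. -/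
theorem jointMoment_eq_mul_of_iIndepFun {μ : Measure Ω} {X : ℕ → ℤ → Ω → ℝ}
    (hX : ∀ i j, Measurable (X i j)) (hind : iIndepFun (fun i ω j => X i j ω) μ) {ι : Type*}
    [DecidableEq ι] (l : ι → ℕ) (w : ι → ℤ) (i₀ : ℕ) (S U : Finset ι)
    (hU : ∀ a ∈ S, a ∈ U ↔ l a = i₀) :
    jointMoment μ (fun a => X (l a) (w a)) S =
      jointMoment μ (fun a => X (l a) (w a)) (S ∩ U) *
        jointMoment μ (fun a => X (l a) (w a)) (S \ U) := by
  classical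
  let G : Finset ℕ := (S.image l).erase i₀
  have hd : Disjoint {i₀} G := by simp [G]
  have h1 := hind.indepFun_finset {i₀} G hd fun i => measurable_pi_iff.2 (hX i)
  -- the product over `V` as a function of the rows in `F`; the value `0` is never used
  let φ (F : Finset ℕ) (V : Finset ι) (x : F → ℤ → ℝ) : ℝ :=
    ∏ a ∈ V, if h : l a ∈ F then x ⟨l a, h⟩ (w a) else 0
  have hφ : ∀ F V, Measurable (φ F V) := by
    intro F V
    refine Finset.measurable_fun_prod V fun a _ => ?_
    by_cases h : l a ∈ F
    · simp only [h, dite_true]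
      exact (measurable_pi_apply (w a)).comp (measurable_pi_apply (⟨l a, h⟩ : F))
    · simp only [h, dite_false]
      exact measurable_const
  have hφe : ∀ (F : Finset ℕ) (V : Finset ι), (∀ a ∈ V, l a ∈ F) →
      (φ F V ∘ fun ω (i : F) j => X i j ω) = fun ω => ∏ a ∈ V, X (l a) (w a) ω := by
    intro F V h
    funext ω
    exact prod_congr rfl fun a ha => by rw [dif_pos (h a ha)]
  have h2 := h1.comp (hφ {i₀} (S ∩ U)) (hφ G (S \ U))
  rw [hφe {i₀} (S ∩ U) fun a ha => by
      rw [mem_inter] at ha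
      exact mem_singleton.2 ((hU a ha.1).1 ha.2),
    hφe G (S \ U) fun a ha => by
      rw [mem_sdiff] at ha
      exact mem_erase.2 ⟨fun h => ha.2 ((hU a ha.1).2 h), mem_image_of_mem l ha.1⟩] at h2
  have hmeas : ∀ V : Finset ι, AEStronglyMeasurable (fun ω => ∏ a ∈ V, X (l a) (w a) ω) μ :=
    fun V => (Finset.measurable_fun_prod V fun a _ => hX _ _).aestronglyMeasurable
  rw [jointMoment, jointMoment, jointMoment, ← Complex.ofReal_mul,
    ← h2.integral_mul_eq_mul_integral (hmeas _) (hmeas _)]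
  congr 2
  funext ω
  rw [Pi.mul_apply, ← prod_union (disjoint_left.2 fun a ha hb =>
    (mem_sdiff.1 hb).2 (mem_inter.1 ha).2), union_comm, sdiff_union_inter]

/-- Cumulants of variables from independent identically distributed rows: they are the cumulants of
one row if all variables come from one row, and vanish otherwise. -/
theorem combCumulant_rows {Ω' : Type*} [MeasurableSpace Ω'] {μ : Measure Ω}
    [IsProbabilityMeasure μ] {ν : Measure Ω'} [IsProbabilityMeasure ν]
    {X : ℕ → ℤ → Ω → ℝ} {Z : ℤ → Ω' → ℝ} (hX : ∀ i j, Measurable (X i j))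
    (hid : ∀ i, IdentDistrib (fun ω j => X i j ω) (fun ω j => Z j ω) μ ν)
    (hind : iIndepFun (fun i ω j => X i j ω) μ) {ι : Type*} [Fintype ι] [DecidableEq ι]
    (l : ι → ℕ) (w : ι → ℤ) {A : Finset ι} (hA : A.Nonempty)
    [Decidable (∀ a ∈ A, ∀ b ∈ A, l a = l b)] :
    combCumulant (jointMoment μ fun a => X (l a) (w a)) A =
      if ∀ a ∈ A, ∀ b ∈ A, l a = l b then combCumulant (jointMoment ν fun a => Z (w a)) A
      else 0 := by
  classical
  split_ifs with h
  · obtain ⟨a, ha⟩ := hA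
    refine combCumulant_congr (jointMoment_empty _) fun T hT => ?_
    rw [← jointMoment_eq_of_identDistrib (hid (l a)) w T, jointMoment, jointMoment]
    congr 2
    funext ω
    exact prod_congr rfl fun b hb => by rw [h b (hT hb) a ha]
  · push Not at h
    obtain ⟨a, ha, b, hb, hab⟩ := h
    refine combCumulant_eq_zero (jointMoment_empty _) (A.filter fun c => l c = l a)
      (fun S hS => ?_) ?_ ?_
    · refine jointMoment_eq_mul_of_iIndepFun hX hind l w (l a) S _ fun c hc => ?_
      simp [hS hc]
    · exact ⟨a, by simp [ha]⟩
    · exact ⟨b, by simp [hb, Ne.symm hab]⟩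

end MomentAlgebra

/-! ### Traces of powers as sums over cyclic words -/

section CyclicWords

open Finset

/-- The cyclic successor in `Fin m`. -/
def cyclicSucc {m : ℕ} (s : Fin m) : Fin m := ⟨((s : ℕ) + 1) % m, Nat.mod_lt _ s.pos⟩

/-- The entries of a power are sums over paths; `c` lists the inner vertices of the path. -/
theorem Matrix.pow_succ_apply_eq_sum {R : Type*} [CommSemiring R] {p : ℕ}
    (Y : Matrix (Fin p) (Fin p) R) (m : ℕ) (i j : Fin p) :
    (Y ^ (m + 1)) i j = ∑ c : Fin m → Fin p,
      ∏ t : Fin (m + 1), Y (Fin.cons (α := fun _ => Fin p) i c t)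
        (Fin.snoc (α := fun _ => Fin p) c j t) := by
  induction m generalizing i with
  | zero => simp [Fin.snoc]
  | succ m ih =>
    rw [pow_succ', Matrix.mul_apply, ← (Fin.consEquiv fun _ => Fin p).sum_comp,
      Fintype.sum_prod_type]
    refine sum_congr rfl fun x _ => ?_
    rw [ih, mul_sum]
    refine sum_congr rfl fun c _ => ?_
    have he : (Fin.consEquiv fun _ : Fin (m + 1) => Fin p) (x, c) =
      Fin.cons (α := fun _ => Fin p) x c := rfl
    rw [Fin.prod_univ_succ (n := m + 1), he, ← Fin.cons_snoc_eq_snoc_cons]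
    simp only [Fin.cons_zero, Fin.cons_succ]

theorem Matrix.trace_pow_eq_sum {R : Type*} [CommSemiring R] {p m : ℕ} (hm : 0 < m)
    (Y : Matrix (Fin p) (Fin p) R) :
    (Y ^ m).trace = ∑ c : Fin m → Fin p, ∏ s, Y (c s) (c (cyclicSucc s)) := by
  obtain ⟨m, rfl⟩ := Nat.exists_eq_succ_of_ne_zero hm.ne'
  rw [Matrix.trace, ← (Fin.consEquiv fun _ => Fin p).sum_comp, Fintype.sum_prod_type]
  refine sum_congr rfl fun i _ => ?_
  rw [Matrix.diag_apply, Matrix.pow_succ_apply_eq_sum]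
  refine sum_congr rfl fun c _ => prod_congr rfl fun t _ => ?_
  have he : (Fin.consEquiv fun _ : Fin (m + 1) => Fin p) (i, c) =
    Fin.cons (α := fun _ => Fin p) i c := rfl
  rw [he]
  congr 1
  induction t using Fin.lastCases with
  | last =>
    have : cyclicSucc (Fin.last m) = 0 := by simp [cyclicSucc]
    rw [this, Fin.snoc_last, Fin.cons_zero]
  | cast s =>
    have : cyclicSucc s.castSucc = s.succ := by
      ext
      simp only [cyclicSucc, Fin.val_castSucc, Fin.val_succ]
      exact Nat.mod_eq_of_lt (by omega)
    rw [this, Fin.snoc_castSucc, Fin.cons_succ]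

/-- Expansion of a trace over words of column indices and of row indices. -/
theorem trace_bandedCov_pow (b : ℝ) (n p : ℕ) (z : ℕ → ℤ → ℝ) {m : ℕ} (hm : 0 < m) :
    ((bandedCov b n p z) ^ m).trace =
      ∑ g : Fin m → Fin p × Fin n,
        (∏ s, (n : ℝ)⁻¹ * bandMatrix b p (g s).1 (g (cyclicSucc s)).1) *
          ∏ s, z (g s).2 (((g s).1 : ℕ) + 1) * z (g s).2 (((g (cyclicSucc s)).1 : ℕ) + 1) := by
  have hY : ∀ i j, bandedCov b n p z i j = ∑ l : Fin n,
      ((n : ℝ)⁻¹ * bandMatrix b p i j) * (z l ((i : ℕ) + 1) * z l ((j : ℕ) + 1)) := by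
    intro i j
    simp only [bandedCov, dataMatrix, Matrix.of_apply, Matrix.mul_apply, Matrix.transpose_apply,
      mul_sum]
    refine sum_congr rfl fun l _ => ?_
    rw [div_mul_div_comm, Real.mul_self_sqrt (Nat.cast_nonneg n)]
    ring
  rw [Matrix.trace_pow_eq_sum hm,
    ← (Equiv.arrowProdEquivProdArrow (Fin m) (fun _ => Fin p) fun _ => Fin n).symm.sum_comp,
    Fintype.sum_prod_type]
  refine sum_congr rfl fun c _ => ?_
  simp only [hY, Fintype.prod_sum]
  refine sum_congr rfl fun l _ => ?_
  rw [← prod_mul_distrib]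
  rfl

end CyclicWords

/-! ### Positions in the concatenation of the blocks -/

section Positions

open Finset

variable {r : ℕ} (k : Fin r → ℕ)

/-- Positions correspond to pairs (block, position within the block). -/
def positionEquiv : Fin (2 * ∑ i, k i) ≃ (i : Fin r) × Fin (2 * k i) :=
  (finCongr (Finset.mul_sum Finset.univ k 2)).trans finSigmaFinEquiv.symm

theorem positionEquiv_apply (a : Fin (2 * ∑ i, k i)) :
    positionEquiv k a = SetPart.blockPos k a := rfl

/-- The first (`e = 0`) or second (`e = 1`) position of the factor number `d.2` of block `d.1`. -/
def position (d : (i : Fin r) × Fin (k i)) (e : Fin 2) : Fin (2 * ∑ i, k i) :=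
  (positionEquiv k).symm ⟨d.1, ⟨2 * (d.2 : ℕ) + e, by omega⟩⟩

/-- The factor to which a position belongs; the two positions of a factor are matched by
`matching₀`. -/
def factorIndex (a : Fin (2 * ∑ i, k i)) : (i : Fin r) × Fin (k i) :=
  ⟨(SetPart.blockPos k a).1, ⟨((SetPart.blockPos k a).2 : ℕ) / 2, by omega⟩⟩

/-- The vertex of the cyclic word at a position; the two occurrences of a vertex are matched by
`matching₁`. -/
def vertexIndex (a : Fin (2 * ∑ i, k i)) : (i : Fin r) × Fin (k i) :=
  ⟨(SetPart.blockPos k a).1,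
    ⟨(((SetPart.blockPos k a).2 : ℕ) + 1) % (2 * k (SetPart.blockPos k a).1) / 2,
      Nat.div_lt_of_lt_mul (Nat.mod_lt _ (SetPart.blockPos k a).2.pos)⟩⟩

/-- The cyclically next vertex of the same block. -/
def nextVertex (d : (i : Fin r) × Fin (k i)) : (i : Fin r) × Fin (k i) := ⟨d.1, cyclicSucc d.2⟩

theorem blockPos_position (d : (i : Fin r) × Fin (k i)) (e : Fin 2) :
    SetPart.blockPos k (position k d e) = ⟨d.1, ⟨2 * (d.2 : ℕ) + e, by omega⟩⟩ :=
  (positionEquiv k).apply_symm_apply _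

theorem factorIndex_position (d : (i : Fin r) × Fin (k i)) (e : Fin 2) :
    factorIndex k (position k d e) = d := by
  have h : ∀ x : (i : Fin r) × Fin (2 * k i), x = ⟨d.1, ⟨2 * (d.2 : ℕ) + e, by omega⟩⟩ →
      (⟨x.1, ⟨(x.2 : ℕ) / 2, by omega⟩⟩ : (i : Fin r) × Fin (k i)) = d := by
    rintro x rfl
    obtain ⟨i, s⟩ := d
    simp only [Sigma.mk.injEq, heq_eq_eq, true_and]
    ext
    simp only
    omega
  exact h _ (blockPos_position k d e)

theorem vertexIndex_position_zero (d : (i : Fin r) × Fin (k i)) :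
    vertexIndex k (position k d 0) = d := by
  have h : ∀ x : (i : Fin r) × Fin (2 * k i), x = ⟨d.1, ⟨2 * (d.2 : ℕ) + (0 : Fin 2), by omega⟩⟩ →
      (⟨x.1, ⟨((x.2 : ℕ) + 1) % (2 * k x.1) / 2,
        Nat.div_lt_of_lt_mul (Nat.mod_lt _ x.2.pos)⟩⟩ : (i : Fin r) × Fin (k i)) = d := by
    rintro x rfl
    obtain ⟨i, s⟩ := d
    simp only [Sigma.mk.injEq, heq_eq_eq, true_and]
    ext
    simp only [Fin.coe_ofNat_eq_mod, Nat.zero_mod, add_zero]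
    rw [Nat.mod_eq_of_lt (by omega)]
    omega
  exact h _ (blockPos_position k d 0)

theorem vertexIndex_position_one (d : (i : Fin r) × Fin (k i)) :
    vertexIndex k (position k d 1) = nextVertex k d := by
  have h : ∀ x : (i : Fin r) × Fin (2 * k i), x = ⟨d.1, ⟨2 * (d.2 : ℕ) + (1 : Fin 2), by omega⟩⟩ →
      (⟨x.1, ⟨((x.2 : ℕ) + 1) % (2 * k x.1) / 2,
        Nat.div_lt_of_lt_mul (Nat.mod_lt _ x.2.pos)⟩⟩ : (i : Fin r) × Fin (k i)) =
        nextVertex k d := by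
    rintro x rfl
    obtain ⟨i, s⟩ := d
    simp only [nextVertex, cyclicSucc, Sigma.mk.injEq, heq_eq_eq, true_and]
    ext
    simp only [Fin.coe_ofNat_eq_mod, Nat.one_mod]
    rw [show 2 * (s : ℕ) + 1 % 2 + 1 = 2 * ((s : ℕ) + 1) by omega, Nat.mul_mod_mul_left]
    omega
  exact h _ (blockPos_position k d 1)

theorem exists_position (a : Fin (2 * ∑ i, k i)) :
    ∃ e, a = position k (factorIndex k a) e := by
  refine ⟨⟨((SetPart.blockPos k a).2 : ℕ) % 2, Nat.mod_lt _ two_pos⟩, ?_⟩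
  rw [position, Equiv.eq_symm_apply, positionEquiv_apply]
  refine Sigma.ext rfl (heq_of_eq (Fin.ext ?_))
  simp only [factorIndex]
  omega

theorem val_position (d : (i : Fin r) × Fin (k i)) (e : Fin 2) :
    (position k d e : ℕ) = 2 * (finSigmaFinEquiv d : ℕ) + e := by
  rw [position, positionEquiv]
  simp only [Equiv.symm_trans_apply, Equiv.symm_symm, finCongr_symm, finCongr_apply,
    Fin.val_cast, finSigmaFinEquiv_apply, mul_add, mul_sum, add_assoc]

theorem val_div_two (a : Fin (2 * ∑ i, k i)) :
    (a : ℕ) / 2 = finSigmaFinEquiv (factorIndex k a) := by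
  obtain ⟨e, he⟩ := exists_position k a
  conv_lhs => rw [he, val_position]
  omega

theorem vertexIndex_fst (a : Fin (2 * ∑ i, k i)) :
    (vertexIndex k a).1 = (factorIndex k a).1 := rfl

theorem factorIndex_surjective : Function.Surjective (factorIndex k) := fun d =>
  ⟨position k d 0, factorIndex_position k d 0⟩

theorem vertexIndex_surjective : Function.Surjective (vertexIndex k) := fun d =>
  ⟨position k d 0, vertexIndex_position_zero k d⟩

/-- A product over the positions of a set of blocks, taken factor by factor. -/
theorem prod_blockUnion {R : Type*} [CommMonoid R] (F : Fin (2 * ∑ i, k i) → R)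
    (S : Finset (Fin r)) :
    ∏ a ∈ blockUnion (fun a => (factorIndex k a).1) S, F a =
      ∏ i ∈ S, ∏ s : Fin (k i), F (position k ⟨i, s⟩ 0) * F (position k ⟨i, s⟩ 1) := by
  have h1 : ∀ i ∈ S, ∏ s : Fin (k i), F (position k ⟨i, s⟩ 0) * F (position k ⟨i, s⟩ 1) =
      ∏ x : Fin (k i) × Fin 2, F (position k ⟨i, x.1⟩ x.2) := fun i _ => by
    rw [Fintype.prod_prod_type]
    exact prod_congr rfl fun s _ => by rw [Fin.prod_univ_two]
  rw [prod_congr rfl h1, prod_sigma']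
  symm
  refine prod_bij (fun x _ => position k ⟨x.1, x.2.1⟩ x.2.2) ?_ ?_ ?_ ?_
  · rintro ⟨i, s, e⟩ hx
    rw [mem_blockUnion, factorIndex_position]
    exact (mem_sigma.1 hx).1
  · rintro ⟨i, s, e⟩ _ ⟨i', s', e'⟩ _ h
    have hd := congrArg (factorIndex k) h
    rw [factorIndex_position, factorIndex_position] at hd
    have he := congrArg Fin.val h
    rw [val_position, val_position, hd] at he
    cases hd
    have : e = e' := Fin.ext (by simpa using he)
    rw [this]
  · intro a ha
    obtain ⟨e, he⟩ := exists_position k a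
    refine ⟨⟨(factorIndex k a).1, (factorIndex k a).2, e⟩, ?_, he.symm⟩
    simpa using ha
  · intro _ _
    rfl

/-- For a word read off from the vertices `c`, the band factors are indexed by the edges of the
cyclic words. -/
theorem bandWord_comp_vertexIndex (b : ℝ) {p : ℕ} (c : (i : Fin r) × Fin (k i) → Fin p) :
    bandWord b (k := ∑ i, k i) (fun a => c (vertexIndex k a)) =
      ∏ d, bandMatrix b p (c d) (c (nextVertex k d)) := by
  rw [bandWord, ← (finSigmaFinEquiv (n := k)).prod_comp]
  refine prod_congr rfl fun d _ => ?_
  have h0 : (⟨2 * (finSigmaFinEquiv d : ℕ), by omega⟩ : Fin (2 * ∑ i, k i)) = position k d 0 :=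
    Fin.ext (by rw [val_position]; rfl)
  have h1 : (⟨2 * (finSigmaFinEquiv d : ℕ) + 1, by omega⟩ : Fin (2 * ∑ i, k i)) =
      position k d 1 := Fin.ext (by rw [val_position]; rfl)
  rw [h0, h1, vertexIndex_position_zero, vertexIndex_position_one]

end Positions

/-! ### Measurability with respect to set partitions and counting -/

namespace SetPart

open Finset

variable {m : ℕ}

theorem isMeasurable_iff_le {β : Type*} {P : SetPart m} {f : Fin m → β} :
    P.IsMeasurable f ↔ P ≤ levelSets f := by
  simp only [le_iff_part, mem_part_levelSets]
  constructor
  · intro h a b hb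
    exact h _ (P.part_mem.2 (mem_univ a)) a (P.mem_part_self.2 (mem_univ a)) b hb
  · intro h A hA a ha b hb
    exact h a b (by rwa [P.part_eq_of_mem hA ha])

theorem isMeasurable_levelSets {β γ : Type*} {g : Fin m → γ} {f : Fin m → β} :
    (levelSets g).IsMeasurable f ↔ ∀ a b, g a = g b → f a = f b := by
  simp only [isMeasurable_iff_le, le_iff_part, mem_part_levelSets]

theorem isMeasurable_sup {β : Type*} {P Q : SetPart m} {f : Fin m → β} :
    (P ⊔ Q).IsMeasurable f ↔ P.IsMeasurable f ∧ Q.IsMeasurable f := by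
  simp only [isMeasurable_iff_le, sup_le_iff]

theorem isMeasurable_iff_part {β : Type*} {P : SetPart m} {f : Fin m → β} :
    P.IsMeasurable f ↔ ∀ a b, P.part a = P.part b → f a = f b := by
  rw [isMeasurable_iff_le, le_iff_part]
  refine forall₂_congr fun a b => ?_
  rw [mem_part_levelSets, P.mem_part_iff_part_eq_part (mem_univ _) (mem_univ _), eq_comm]

theorem isMeasurable_part (P : SetPart m) : P.IsMeasurable P.part :=
  isMeasurable_iff_part.2 fun _ _ h => h

theorem isPartitionOf_parts (P : SetPart m) : IsPartitionOf P.parts univ where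
  nonempty _ hA := P.nonempty_of_mem_parts hA
  mem_iff x := ⟨fun _ => mem_univ x, fun _ => P.exists_mem (mem_univ x)⟩
  eq_of_mem A hA B hB x hxA hxB := by
    rw [← P.part_eq_of_mem hA hxA, P.part_eq_of_mem hB hxB]

theorem sum_partitionsOf_univ {R : Type*} [AddCommMonoid R] (F : Finset (Finset (Fin m)) → R) :
    ∑ P ∈ partitionsOf univ, F P = ∑ Q : SetPart m, F Q.parts := by
  symm
  refine sum_bij (fun Q _ => Q.parts) (fun Q _ => mem_partitionsOf.2 Q.isPartitionOf_parts)
    (fun Q _ Q' _ h => Finpartition.ext h) (fun P hP => ?_) fun _ _ => rfl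
  have h := mem_partitionsOf.1 hP
  refine ⟨Finpartition.ofExistsUnique P (fun A _ => subset_univ A) (fun x hx => ?_)
    (fun h0 => not_nonempty_empty (h.nonempty ∅ h0)), mem_univ _, rfl⟩
  obtain ⟨A, hA, hxA⟩ := (h.mem_iff x).2 hx
  exact ⟨A, ⟨hA, hxA⟩, fun B hB => h.eq_of_mem B hB.1 A hA x hB.2 hxA⟩

end SetPart

section Counting

open Finset

/-- The functions constant on the fibres of a surjection `q` are those that factor through `q`. -/
theorem filter_factors_eq_image {X Y N : Type*} [Fintype X] [Fintype Y] [Fintype N]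
    [DecidableEq X] [DecidableEq Y] [DecidableEq N] {q : X → Y} (hq : Function.Surjective q)
    (p : (X → N) → Prop) [DecidablePred p] (hp : ∀ f, p f ↔ ∀ a b, q a = q b → f a = f b) :
    univ.filter p = univ.image fun g : Y → N => g ∘ q := by
  ext f
  simp only [mem_filter, mem_univ, true_and, mem_image, hp]
  constructor
  · intro h
    refine ⟨fun y => f (Function.surjInv hq y), funext fun a => ?_⟩
    exact h _ _ (Function.surjInv_eq hq _)
  · rintro ⟨g, rfl⟩ a b hab
    simp [hab]

theorem SetPart.card_isMeasurable {m : ℕ} (P : SetPart m) (N : Type*) [Fintype N]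
    [DecidableEq N] [DecidablePred fun f : Fin m → N => P.IsMeasurable f] :
    (univ.filter fun f : Fin m → N => P.IsMeasurable f).card =
      Fintype.card N ^ P.parts.card := by
  classical
  let q : Fin m → P.parts := fun a => ⟨P.part a, P.part_mem.2 (mem_univ a)⟩
  have hq : Function.Surjective q := by
    rintro ⟨A, hA⟩
    obtain ⟨a, ha⟩ := P.nonempty_of_mem_parts hA
    exact ⟨a, Subtype.ext (P.part_eq_of_mem hA ha)⟩
  rw [filter_factors_eq_image hq _ fun f => by
      rw [SetPart.isMeasurable_iff_part]; simp [q],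
    card_image_of_injective _ hq.injective_comp_right, card_univ, Fintype.card_fun,
    Fintype.card_coe]

variable {r : ℕ} (k : Fin r → ℕ)

theorem isMeasurable_matching₀ {β : Type*} {f : Fin (2 * ∑ i, k i) → β} :
    (SetPart.matching₀ (∑ i, k i)).IsMeasurable f ↔
      ∀ a b, factorIndex k a = factorIndex k b → f a = f b := by
  rw [SetPart.matching₀, SetPart.isMeasurable_levelSets]
  refine forall₂_congr fun a b => ?_
  rw [val_div_two k, val_div_two k, Fin.val_inj, finSigmaFinEquiv.apply_eq_iff_eq]

theorem isMeasurable_matching₁ {β : Type*} {f : Fin (2 * ∑ i, k i) → β} :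
    (SetPart.matching₁ k).IsMeasurable f ↔
      ∀ a b, vertexIndex k a = vertexIndex k b → f a = f b := by
  rw [SetPart.matching₁, SetPart.isMeasurable_levelSets]
  have hinj : ∀ d d' : (i : Fin r) × Fin (k i), ((d.1, (d.2 : ℕ)) : Fin r × ℕ) = (d'.1, (d'.2 : ℕ)) ↔
      d = d' := by
    rintro ⟨i, s⟩ ⟨j, t⟩
    constructor
    · intro h
      obtain ⟨rfl, h⟩ := Prod.mk.inj h
      exact Sigma.ext rfl (heq_of_eq (Fin.ext h))
    · rintro h
      rw [h]
  refine forall₂_congr fun a b => ?_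
  exact imp_congr_left (hinj (vertexIndex k a) (vertexIndex k b))

/-- The number of choices of rows that are constant on the parts of `Q`. -/
theorem card_rows_isMeasurable (Q : SetPart (2 * ∑ i, k i)) (n : ℕ)
    [DecidablePred fun l : (i : Fin r) × Fin (k i) → Fin n =>
      Q.IsMeasurable fun a => l (factorIndex k a)] :
    (univ.filter fun l : (i : Fin r) × Fin (k i) → Fin n =>
      Q.IsMeasurable fun a => l (factorIndex k a)).card =
      n ^ (SetPart.matching₀ (∑ i, k i) ⊔ Q).parts.card := by
  classical
  have h := SetPart.card_isMeasurable (SetPart.matching₀ (∑ i, k i) ⊔ Q) (Fin n)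
  rw [Fintype.card_fin] at h
  rw [← h]
  refine card_bij (fun l _ a => l (factorIndex k a)) (fun l hl => ?_) (fun l _ l' _ h => ?_)
    fun f hf => ?_
  · simp only [mem_filter, mem_univ, true_and] at hl ⊢
    rw [SetPart.isMeasurable_sup, isMeasurable_matching₀]
    exact ⟨fun a b h => by simp only [h], hl⟩
  · exact (factorIndex_surjective k).injective_comp_right h
  · simp only [mem_filter, mem_univ, true_and] at hf
    rw [SetPart.isMeasurable_sup, isMeasurable_matching₀] at hf
    have hfl : (fun a => f (position k (factorIndex k a) 0)) = f := funext fun a =>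
      hf.1 _ _ (factorIndex_position k _ _)
    refine ⟨fun d => f (position k d 0), ?_, hfl⟩
    simp only [mem_filter, mem_univ, true_and]
    rw [hfl]
    exact hf.2

/-- The two matchings together connect each block. -/
theorem eq_of_factorIndex_fst_eq {β : Type*} {f : Fin (2 * ∑ i, k i) → β}
    (h₀ : (SetPart.matching₀ (∑ i, k i)).IsMeasurable f)
    (h₁ : (SetPart.matching₁ k).IsMeasurable f) {a b : Fin (2 * ∑ i, k i)}
    (hab : (factorIndex k a).1 = (factorIndex k b).1) : f a = f b := by
  rw [isMeasurable_matching₀] at h₀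
  rw [isMeasurable_matching₁] at h₁
  have hstep : ∀ (i : Fin r) (t : ℕ) (ht : t < k i),
      f (position k ⟨i, ⟨t, ht⟩⟩ 0) = f (position k ⟨i, ⟨0, by omega⟩⟩ 0) := by
    intro i t
    induction t with
    | zero => exact fun _ => rfl
    | succ t ih =>
      intro ht
      rw [← ih (by omega)]
      have hnext : nextVertex k ⟨i, ⟨t, by omega⟩⟩ = ⟨i, ⟨t + 1, ht⟩⟩ := by
        simp only [nextVertex, cyclicSucc, Sigma.mk.injEq, heq_eq_eq, true_and]
        exact Fin.ext (Nat.mod_eq_of_lt ht)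
      have e1 : f (position k ⟨i, ⟨t + 1, ht⟩⟩ 0) = f (position k ⟨i, ⟨t, by omega⟩⟩ 1) :=
        h₁ _ _ (by rw [vertexIndex_position_zero, vertexIndex_position_one, hnext])
      rw [e1]
      exact h₀ _ _ (by rw [factorIndex_position, factorIndex_position])
  have hall : ∀ a, f a = f (position k ⟨(factorIndex k a).1, ⟨0, (factorIndex k a).2.pos⟩⟩ 0) := by
    intro a
    rw [← hstep _ _ (factorIndex k a).2.isLt]
    exact h₀ _ _ (factorIndex_position k _ _).symm
  rw [hall a, hall b]
  congr 2
  rw [Sigma.mk.injEq]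
  exact ⟨hab, by rw [Fin.heq_ext_iff (congrArg k hab)]⟩

/-- A partition connects all the blocks iff its join with the two matchings is the one-part
partition. -/
theorem connectsBlocks_iff (hr : 0 < r) (hk : ∀ i, 0 < k i) (Q : SetPart (2 * ∑ i, k i)) :
    ConnectsBlocks (fun a => (factorIndex k a).1) Q.parts univ ↔
      (SetPart.matching₀ (∑ i, k i) ⊔ SetPart.matching₁ k ⊔ Q).parts.card = 1 := by
  set R := SetPart.matching₀ (∑ i, k i) ⊔ SetPart.matching₁ k ⊔ Q with hR
  let a₀ : Fin (2 * ∑ i, k i) := position k ⟨⟨0, hr⟩, ⟨0, hk _⟩⟩ 0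
  constructor
  · intro hc
    have hmeas : R.IsMeasurable R.part := R.isMeasurable_part
    rw [hR, SetPart.isMeasurable_sup, SetPart.isMeasurable_sup, ← hR] at hmeas
    have hT := hc (univ.filter fun i => ∀ a, (factorIndex k a).1 = i → R.part a = R.part a₀)
      (subset_univ _) ⟨(factorIndex k a₀).1, by
        simp only [mem_filter, mem_univ, true_and]
        exact fun a ha => eq_of_factorIndex_fst_eq k hmeas.1.1 hmeas.1.2 ha⟩ (by
        intro A hA x hx y hy hxT
        simp only [mem_filter, mem_univ, true_and] at hxT ⊢
        intro a ha
        rw [eq_of_factorIndex_fst_eq k hmeas.1.1 hmeas.1.2 ha, ← hxT x rfl]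
        exact hmeas.2 A hA y hy x hx)
    have hall : ∀ a, R.part a = R.part a₀ := fun a => by
      have := hT.symm ▸ mem_univ (factorIndex k a).1
      simp only [mem_filter, mem_univ, true_and] at this
      exact this a rfl
    rw [card_eq_one]
    refine ⟨R.part a₀, eq_singleton_iff_unique_mem.2
      ⟨R.part_mem.2 (mem_univ _), fun A hA => ?_⟩⟩
    obtain ⟨a, ha⟩ := R.nonempty_of_mem_parts hA
    rw [← hall a, R.part_eq_of_mem hA ha]
  · intro hcard T _ hT hsat
    obtain ⟨A, hA⟩ := card_eq_one.1 hcard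
    have hpart : ∀ a, R.part a = A := fun a =>
      mem_singleton.1 (hA ▸ R.part_mem.2 (mem_univ a))
    let f : Fin (2 * ∑ i, k i) → Prop := fun a => (factorIndex k a).1 ∈ T
    have hf : R.IsMeasurable f := by
      rw [hR, SetPart.isMeasurable_sup, SetPart.isMeasurable_sup, isMeasurable_matching₀,
        isMeasurable_matching₁]
      refine ⟨⟨fun a b h => by simp only [f, h], fun a b h => ?_⟩, fun B hB x hx y hy => ?_⟩
      · simp only [f, ← vertexIndex_fst, h]
      · exact propext ⟨hsat B hB x hx y hy, hsat B hB y hy x hx⟩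
    obtain ⟨i, hi⟩ := hT
    refine eq_univ_iff_forall.2 fun j => ?_
    have h := SetPart.isMeasurable_iff_part.1 hf (position k ⟨i, ⟨0, hk i⟩⟩ 0)
      (position k ⟨j, ⟨0, hk j⟩⟩ 0) (by rw [hpart, hpart])
    simp only [f, factorIndex_position] at h
    exact h ▸ hi

end Counting

/-! ### Cumulants of traces -/

section Traces

open Finset

theorem partCumulant_eq_prod {Ω : Type*} [MeasurableSpace Ω] {μ : Measure Ω}
    [IsProbabilityMeasure μ] {m : ℕ} (Q : SetPart m) {X : Fin m → Ω → ℝ}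
    (hX : ∀ a, HasAllMoments (X a) μ) :
    partCumulant μ Q X = ∏ A ∈ Q.parts, combCumulant (jointMoment μ X) A := by
  refine prod_congr rfl fun A hA => ?_
  have hpos : 0 < A.card := card_pos.2 (Q.nonempty_of_mem_parts hA)
  rw [jointCumulant_eq_combCumulant hpos fun i => hX _]
  have h := combCumulant_map (A.orderEmbOfFin rfl).toEmbedding (jointMoment_empty (μ := μ) X)
    (S := univ) ⟨⟨0, hpos⟩, mem_univ _⟩
  rw [map_orderEmbOfFin_univ] at h
  rw [← h]
  congr 1
  funext T
  simp [jointMoment]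

variable {Ω : Type*} [MeasurableSpace Ω] (P : Measure Ω) [IsProbabilityMeasure P]

/-- Multilinearity and the formula of Leonov and Shiryaev, applied to the expansion of the traces
over vertex words `c` and row words `l`. -/
theorem jointCumulant_trace_eq_sum (X : ℕ → ℤ → Ω → ℝ) (hX : ∀ i j, HasAllMoments (X i j) P)
    (p n : ℕ) (b : ℝ) {r : ℕ} (hr : 0 < r) (k : Fin r → ℕ) (hk : ∀ i, 0 < k i) :
    jointCumulant P
        (fun (i : Fin r) ω => ((bandedCov b n p fun l j => X l j ω) ^ k i).trace) =
      ∑ c : (i : Fin r) × Fin (k i) → Fin p, ∑ l : (i : Fin r) × Fin (k i) → Fin n,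
        ((n : ℂ)⁻¹ ^ (∑ i, k i) *
          (bandWord b (k := ∑ i, k i) (fun a => c (vertexIndex k a)) : ℂ)) *
        connectedSum (fun a => (factorIndex k a).1)
          (combCumulant (jointMoment P fun a =>
            X (l (factorIndex k a)) (((c (vertexIndex k a) : ℕ) : ℤ) + 1))) univ := by
  classical
  have hne : (univ : Finset (Fin r)).Nonempty := ⟨⟨0, hr⟩, mem_univ _⟩
  let x : ℕ → ℤ → momentAlgebra P := fun i j => ⟨X i j, hX i j⟩
  let coef : (i : Fin r) → (Fin (k i) → Fin p × Fin n) → ℝ := fun i g =>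
    ∏ s, (n : ℝ)⁻¹ * bandMatrix b p (g s).1 (g (cyclicSucc s)).1
  let mono : (i : Fin r) → (Fin (k i) → Fin p × Fin n) → momentAlgebra P := fun i g =>
    ∏ s, x (g s).2 (((g s).1 : ℕ) + 1) * x (g s).2 (((g (cyclicSucc s)).1 : ℕ) + 1)
  let u : Fin r → momentAlgebra P := fun i => ∑ g, coef i g • mono i g
  have hu : ∀ i, (u i : Ω → ℝ) = fun ω => ((bandedCov b n p fun l j => X l j ω) ^ k i).trace := by
    intro i
    funext ω
    rw [trace_bandedCov_pow b n p _ (hk i)]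
    simp only [u, AddSubmonoidClass.coe_finsetSum, Finset.sum_apply, SetLike.val_smul,
      Pi.smul_apply, smul_eq_mul, mono, SubmonoidClass.coe_finsetProd, Finset.prod_apply,
      MulMemClass.coe_mul, Pi.mul_apply, coef, x]
  have hcum : jointCumulant P
      (fun (i : Fin r) ω => ((bandedCov b n p fun l j => X l j ω) ^ k i).trace) =
      cumulantMap (Fin r) (meanFunctional P) (meanFunctional_one P) u := by
    rw [cumulantMap_apply]
    simp only [meanFunctional_prod, hu]
    exact jointCumulant_eq_combCumulant hr fun i => by rw [← hu i]; exact (u i).2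
  -- functions on each block correspond to pairs of functions on all vertices
  let e : (((i : Fin r) × Fin (k i) → Fin p) × ((i : Fin r) × Fin (k i) → Fin n)) ≃
      ((i : Fin r) → Fin (k i) → Fin p × Fin n) :=
    (Equiv.arrowProdEquivProdArrow _ (fun _ => Fin p) fun _ => Fin n).symm.trans
      (Equiv.piCurry fun _ _ => Fin p × Fin n)
  rw [hcum, MultilinearMap.map_sum, ← e.sum_comp, Fintype.sum_prod_type]
  refine sum_congr rfl fun c _ => sum_congr rfl fun l _ => ?_
  rw [MultilinearMap.map_smul_univ, Complex.real_smul]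
  congr 1
  · have h1 : ∏ i, coef i (e (c, l) i) = ∏ d : (i : Fin r) × Fin (k i),
        (n : ℝ)⁻¹ * bandMatrix b p (c d) (c (nextVertex k d)) := by
      rw [Fintype.prod_sigma]
      rfl
    rw [h1, prod_mul_distrib, ← bandWord_comp_vertexIndex, prod_const, card_univ,
      Fintype.card_sigma]
    simp
  · rw [cumulantMap_apply, ← combCumulant_blockUnion _ (jointMoment_empty _) hne]
    congr 1
    funext T
    rw [← meanFunctional_prod P fun a =>
      x (l (factorIndex k a)) (((c (vertexIndex k a) : ℕ) : ℤ) + 1), prod_blockUnion]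
    simp only [factorIndex_position, vertexIndex_position_zero, vertexIndex_position_one]
    rfl

variable {Ω' : Type*} [MeasurableSpace Ω'] (P' : Measure Ω') [IsProbabilityMeasure P']

/-- Summation over the row words: the independent rows contribute only if the rows agree on the
parts of `Q`. -/
theorem sum_rows_prod_combCumulant (X : ℕ → ℤ → Ω → ℝ) (Z : ℤ → Ω' → ℝ)
    (hX : ∀ i j, Measurable (X i j))
    (hid : ∀ i, IdentDistrib (fun ω j => X i j ω) (fun ω j => Z j ω) P P')
    (hind : iIndepFun (fun i ω j => X i j ω) P) (hZ : ∀ j, HasAllMoments (Z j) P')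
    {p n r : ℕ} (k : Fin r → ℕ) (Q : SetPart (2 * ∑ i, k i))
    (w : Fin (2 * ∑ i, k i) → Fin p) :
    ∑ l : (i : Fin r) × Fin (k i) → Fin n, ∏ A ∈ Q.parts,
        combCumulant (jointMoment P fun a =>
          X (l (factorIndex k a)) (((w a : ℕ) : ℤ) + 1)) A =
      (n : ℂ) ^ (SetPart.matching₀ (∑ i, k i) ⊔ Q).parts.card * wordCumulant P' Z Q w := by
  classical
  have h1 : ∀ l : (i : Fin r) × Fin (k i) → Fin n, ∏ A ∈ Q.parts,
        combCumulant (jointMoment P fun a =>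
          X (l (factorIndex k a)) (((w a : ℕ) : ℤ) + 1)) A =
      if Q.IsMeasurable fun a => l (factorIndex k a) then wordCumulant P' Z Q w else 0 := by
    intro l
    have hrow : ∀ A ∈ Q.parts, combCumulant (jointMoment P fun a =>
          X (l (factorIndex k a)) (((w a : ℕ) : ℤ) + 1)) A =
        if ∀ a ∈ A, ∀ b ∈ A, l (factorIndex k a) = l (factorIndex k b) then
          combCumulant (jointMoment P' fun a => Z (((w a : ℕ) : ℤ) + 1)) A else 0 := by
      intro A hA
      rw [combCumulant_rows hX hid hind (fun a => (l (factorIndex k a) : ℕ)) _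
        (Q.nonempty_of_mem_parts hA)]
      simp only [Fin.val_inj]
    by_cases h : Q.IsMeasurable fun a => l (factorIndex k a)
    · rw [if_pos h, wordCumulant, partCumulant_eq_prod Q fun a => hZ _]
      exact prod_congr rfl fun A hA => by rw [hrow A hA, if_pos (h A hA)]
    · rw [if_neg h]
      simp only [SetPart.IsMeasurable, not_forall] at h
      obtain ⟨A, hA, a, ha, b, hb, hab⟩ := h
      refine prod_eq_zero hA ?_
      rw [hrow A hA, if_neg fun hall => hab (hall a ha b hb)]
  rw [sum_congr rfl fun l _ => h1 l, ← sum_filter, sum_const, nsmul_eq_mul,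
    card_rows_isMeasurable, Nat.cast_pow]

/-- Singletons do not contribute, because the variables are centred. -/
theorem wordCumulant_eq_zero {Z : ℤ → Ω' → ℝ} (hZ : ∀ j, HasAllMoments (Z j) P')
    (hmean : ∀ j, ∫ ω, Z j ω ∂P' = 0) {p m : ℕ} {Q : SetPart m} (hQ : ¬ Q.IsPart₂)
    (w : Fin m → Fin p) : wordCumulant P' Z Q w = 0 := by
  simp only [SetPart.IsPart₂, not_forall, not_le] at hQ
  obtain ⟨A, hA, hcard⟩ := hQ
  have h1 : A.card = 1 := by
    have := card_pos.2 (Q.nonempty_of_mem_parts hA)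
    omega
  obtain ⟨a, rfl⟩ := card_eq_one.1 h1
  rw [wordCumulant, partCumulant_eq_prod Q fun a => hZ _]
  refine prod_eq_zero hA ?_
  rw [combCumulant_singleton (jointMoment_empty _)]
  simp [jointMoment, hmean]

end Traces

theorem proposition5p2
    {Ω Ω' : Type*} [MeasurableSpace Ω] [MeasurableSpace Ω']
    (P : Measure Ω) [IsProbabilityMeasure P] (P' : Measure Ω') [IsProbabilityMeasure P']
    -- the stationary sequence `Z_j`, with moments of all orders and mean zero
    (Z : ℤ → Ω' → ℝ) (hZmeas : ∀ j, Measurable (Z j))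
    (hZstat : ∀ m : ℤ, IdentDistrib (fun ω j => Z (j + m) ω) (fun ω j => Z j ω) P' P')
    (hZmom : ∀ q : ℕ, 1 ≤ q → Integrable (fun ω => |Z 0 ω| ^ q) P')
    (hZmean : ∫ ω, Z 0 ω ∂P' = 0)
    -- the i.i.d. copies `Z^{(i)}` of the sequence `Z`
    (Zc : ℕ → ℤ → Ω → ℝ) (hZcmeas : ∀ i j, Measurable (Zc i j))
    (hZcid : ∀ i, IdentDistrib (fun ω j => Zc i j ω) (fun ω j => Z j ω) P P')
    (hZcindep : iIndepFun (fun i ω j => Zc i j ω) P)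
    (p n : ℕ) (hp : 0 < p) (hn : 0 < n) (b : ℝ) (hb : 0 < b)
    (r : ℕ) (hr : 0 < r) (k : Fin r → ℕ) (hk : ∀ i, 0 < k i) :
    jointCumulant P
        (fun (i : Fin r) ω => ((bandedCov b n p fun l j => Zc l j ω) ^ k i).trace) =
      ∑ Q : SetPart (2 * ∑ i, k i) with
          Q.IsPart₂ ∧ (SetPart.matching₀ (∑ i, k i) ⊔ SetPart.matching₁ k ⊔ Q).parts.card = 1,
        (n : ℂ) ^ (-((∑ i, k i : ℕ) : ℤ)
            + ((SetPart.matching₀ (∑ i, k i) ⊔ Q).parts.card : ℤ)) *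
          ∑ w : Fin (2 * ∑ i, k i) → Fin p with (SetPart.matching₁ k).IsMeasurable w,
            (bandWord b w : ℂ) * wordCumulant P' Z Q w := by
  classical
  have hshift : ∀ j, IdentDistrib (Z j) (Z 0) P' P' := fun j => by
    have h := (hZstat j).comp (measurable_pi_apply (0 : ℤ))
    simpa [Function.comp_def] using h
  have hZ : ∀ j, HasAllMoments (Z j) P' := fun j => HasAllMoments.of_identDistrib (hshift j)
    (HasAllMoments.of_integrable_pow (hZmeas 0).aestronglyMeasurable hZmom)
  have hmean : ∀ j, ∫ ω, Z j ω ∂P' = 0 := fun j => (hshift j).integral_eq.trans hZmean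
  have hZc : ∀ i j, HasAllMoments (Zc i j) P := fun i j =>
    HasAllMoments.of_identDistrib ((hZcid i).comp (measurable_pi_apply j)) (hZ j)
  have hn0 : (n : ℂ) ≠ 0 := by exact_mod_cast hn.ne'
  rw [jointCumulant_trace_eq_sum P Zc hZc p n b hr k hk]
  -- the partitions connecting the blocks are those of the statement, singletons still allowed
  have hconn : ∀ (c : (i : Fin r) × Fin (k i) → Fin p) (l : (i : Fin r) × Fin (k i) → Fin n),
      connectedSum (fun a => (factorIndex k a).1)
          (combCumulant (jointMoment P fun a =>
            Zc (l (factorIndex k a)) (((c (vertexIndex k a) : ℕ) : ℤ) + 1))) Finset.univ =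
        ∑ Q : SetPart (2 * ∑ i, k i) with
            (SetPart.matching₀ (∑ i, k i) ⊔ SetPart.matching₁ k ⊔ Q).parts.card = 1,
          ∏ A ∈ Q.parts, combCumulant (jointMoment P fun a =>
            Zc (l (factorIndex k a)) (((c (vertexIndex k a) : ℕ) : ℤ) + 1)) A := by
    intro c l
    have huniv : blockUnion (fun a => (factorIndex k a).1) Finset.univ = Finset.univ := by
      ext
      simp
    rw [connectedSum, huniv, Finset.sum_filter, SetPart.sum_partitionsOf_univ, Finset.sum_filter]
    exact Finset.sum_congr rfl fun Q _ => by rw [if_congr (connectsBlocks_iff k hr hk Q) rfl rfl]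
  -- the words constant on the pairs of `matching₁` are the words read off from the vertices
  have hcols : ∀ Q : SetPart (2 * ∑ i, k i),
      ∑ w : Fin (2 * ∑ i, k i) → Fin p with (SetPart.matching₁ k).IsMeasurable w,
        (bandWord b w : ℂ) * wordCumulant P' Z Q w =
      ∑ c : (i : Fin r) × Fin (k i) → Fin p,
        (bandWord b (k := ∑ i, k i) (fun a => c (vertexIndex k a)) : ℂ) *
          wordCumulant P' Z Q fun a => c (vertexIndex k a) := by
    intro Q
    rw [filter_factors_eq_image (vertexIndex_surjective k) _ fun f => isMeasurable_matching₁ k,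
      Finset.sum_image (vertexIndex_surjective k).injective_comp_right.injOn]
    rfl
  have hfilter : ∑ Q : SetPart (2 * ∑ i, k i) with
          Q.IsPart₂ ∧ (SetPart.matching₀ (∑ i, k i) ⊔ SetPart.matching₁ k ⊔ Q).parts.card = 1,
        (n : ℂ) ^ (-((∑ i, k i : ℕ) : ℤ)
            + ((SetPart.matching₀ (∑ i, k i) ⊔ Q).parts.card : ℤ)) *
          ∑ w : Fin (2 * ∑ i, k i) → Fin p with (SetPart.matching₁ k).IsMeasurable w,
            (bandWord b w : ℂ) * wordCumulant P' Z Q w =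
      ∑ Q : SetPart (2 * ∑ i, k i) with
          (SetPart.matching₀ (∑ i, k i) ⊔ SetPart.matching₁ k ⊔ Q).parts.card = 1,
        (n : ℂ) ^ (-((∑ i, k i : ℕ) : ℤ)
            + ((SetPart.matching₀ (∑ i, k i) ⊔ Q).parts.card : ℤ)) *
          ∑ w : Fin (2 * ∑ i, k i) → Fin p with (SetPart.matching₁ k).IsMeasurable w,
            (bandWord b w : ℂ) * wordCumulant P' Z Q w := by
    refine Finset.sum_subset (fun Q hQ => ?_) fun Q hQ hQ' => ?_
    · rw [Finset.mem_filter] at hQ ⊢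
      exact ⟨hQ.1, hQ.2.2⟩
    · rw [Finset.mem_filter] at hQ hQ'
      have hQ2 : ¬ Q.IsPart₂ := fun h => hQ' ⟨hQ.1, h, hQ.2⟩
      have h0 : ∑ w : Fin (2 * ∑ i, k i) → Fin p with (SetPart.matching₁ k).IsMeasurable w,
          (bandWord b w : ℂ) * wordCumulant P' Z Q w = 0 := Finset.sum_eq_zero fun w _ => by
        rw [wordCumulant_eq_zero P' hZ hmean hQ2 w, mul_zero]
      rw [h0, mul_zero]
  rw [hfilter]
  simp only [hconn, hcols, Finset.mul_sum]
  rw [Finset.sum_congr rfl fun c _ => Finset.sum_comm, Finset.sum_comm]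
  refine Finset.sum_congr rfl fun Q _ => Finset.sum_congr rfl fun c _ => ?_
  rw [← Finset.mul_sum, sum_rows_prod_combCumulant P P' Zc Z hZcmeas hZcid hZcindep hZ k Q
    fun a => c (vertexIndex k a), zpow_add₀ hn0, zpow_neg, zpow_natCast, zpow_natCast, inv_pow]
  ring
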